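/- Let $G$ be a countably infinite discrete group. A \emph{$G$-flow} is an action of $G$ by homeomorphisms on a nonempty compact Hausdorff space; it is \emph{minimal} if every orbit is dense. A \emph{$G$-system} is a standard Borel probability space $(X,\mu)$ with an action of $G$ by Borel $\mu$-preserving bijections; it is \emph{free} if $\mu$-almost every point has trivial stabilizer. Two $G$-systems $(X,\mu)$ and $(Y,\nu)$ are \emph{isomorphic} if there are a $G$-invariant Borel set $X'\subseteq X$ with $\mu(X')=1$ and an injective $G$-equivariant Borel map $f\colon X'\to Y$ with $\nu=f_*\mu$. A metrizable $G$-flow $Y$ is \emph{model-universal} if for every free $G$-system $(X,\mu)$ there is a $G$-invariant Borel probability measure $\nu$ on $Y$ such that $(X,\mu)$ and $(Y,\nu)$ are isomorphic. Theorem. For every countably infinite group $G$ there is a family $\{Y_i : i<\mathfrak{c}\}$ (where $\mathfrak c=2^{\aleph_0}$) of minimal, model-universal $G$-flows that is \emph{mutually disjoint}, meaning that the product $\prod_{i<\mathfrak{c}} Y_i$, with the product topology and the diagonal action of $G$, is a minimal $G$-flow. -/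

import Mathlib

open MeasureTheory

universe u v w

/-- `Y` is a `G`-flow: the (discrete) group `G` acts by homeomorphisms on the nonempty compact
Hausdorff space `Y`. (Each `y ↦ g • y` is continuous, with continuous inverse `y ↦ g⁻¹ • y`.) -/
structure IsFlow (G : Type u) (Y : Type v) [Group G] [TopologicalSpace Y] [MulAction G Y] :
    Prop where
  nonempty : Nonempty Y
  compact : CompactSpace Y
  hausdorff : T2Space Y
  continuous_smul : ∀ g : G, Continuous fun y : Y => g • y

/-- `Y` is a minimal `G`-flow: every orbit is dense. -/
structure IsMinimalFlow (G : Type u) (Y : Type v) [Group G] [TopologicalSpace Y] [MulAction G Y] :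
    Prop where
  isFlow : IsFlow G Y
  dense_orbit : ∀ y : Y, Dense (MulAction.orbit G y)

/-- A family of `G`-flows is mutually disjoint if its product, with the product topology and
the diagonal action, is a minimal flow. -/
def MutuallyDisjoint (G : Type u) [Group G] {I : Type v} (Y : I → Type w)
    [∀ i, TopologicalSpace (Y i)] [∀ i, MulAction G (Y i)] : Prop :=
  IsMinimalFlow G (∀ i, Y i)

/-- `(X, μ)` is a `G`-system: `G` acts on the standard Borel probability space `(X, μ)`
by Borel measure-preserving bijections. -/
structure IsGSystem (G : Type u) {X : Type v} [Group G] [MeasurableSpace X] [MulAction G X]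
    (μ : Measure X) : Prop where
  standardBorel : StandardBorelSpace X
  probability : IsProbabilityMeasure μ
  measurePreserving : ∀ g : G, MeasurePreserving (fun x : X => g • x) μ μ

/-- `(X, μ)` is a free `G`-system: almost every point has trivial stabilizer. -/
structure IsFreeGSystem (G : Type u) {X : Type v} [Group G] [MeasurableSpace X] [MulAction G X]
    (μ : Measure X) : Prop where
  isGSystem : IsGSystem G μ
  free : ∀ᵐ x ∂μ, MulAction.stabilizer G x = ⊥

/-- The `G`-systems `(X, μ)` and `(Y, ν)` are isomorphic: on a `G`-invariant Borel set `X'` with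
`μ X' = 1` there is an injective `G`-equivariant Borel map to `Y` that pushes `μ` to `ν`.
(The values of `f` off the conull set `X'` play no role.) -/
def IsomorphicGSystems (G : Type u) {X : Type v} {Y : Type w} [Group G]
    [MeasurableSpace X] [MulAction G X] [MeasurableSpace Y] [MulAction G Y]
    (μ : Measure X) (ν : Measure Y) : Prop :=
  ∃ (X' : Set X) (f : X → Y),
    MeasurableSet X' ∧ μ X' = 1 ∧ (∀ g : G, ∀ x ∈ X', g • x ∈ X') ∧
    Measurable f ∧ Set.InjOn f X' ∧ (∀ g : G, ∀ x ∈ X', f (g • x) = g • f x) ∧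
    μ.map f = ν

/-- `Y` is a model-universal flow: it is a metrizable `G`-flow, and every free `G`-system is
isomorphic to `(Y, ν)` for some `G`-invariant Borel probability measure `ν` on `Y`. -/
structure IsModelUniversal (G : Type u) (Y : Type v) [Group G] [TopologicalSpace Y]
    [MulAction G Y] : Prop where
  isFlow : IsFlow G Y
  metrizable : TopologicalSpace.MetrizableSpace Y
  universal : ∀ (X : Type w) [MeasurableSpace X] [MulAction G X] (μ : Measure X),
    IsFreeGSystem G μ →
      letI : MeasurableSpace Y := borel Y
      ∃ ν : Measure Y, IsGSystem G ν ∧ IsomorphicGSystems G μ ν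

/-!
Every flow of the family is a subshift of `(2 × 2)^ℕ` over `G`, the intersection of a decreasing
sequence of sets `Z₀ ⊇ Z₁ ⊇ …` of configurations `G → ℕ → Bool × Bool`, where `Zₙ` restricts only
the layers below `n`; each layer consists of a data bit and a mark bit. To pass from `Zₙ` to
`Zₙ₊₁` (`blockRefine`), one asks that the marks in layer `n` form a maximal independent set for
some finite `U ⊆ G`, and that a fixed large pattern from `Zₙ` is displayed around every mark. All
sets `Zₙ` are irreducible, in the sense that configurations given on far apart pieces can be glued
(`Glues`). The gluing is done in a Borel and equivariant way over any free Borel `G`-space; this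
covers both the combinatorial situation, where that space is `G` itself, and the measurable one.
That irreducibility survives a refinement (`glues_blockRefine`) rests on the existence of maximal
independent Borel sets inside given Borel sets (`FreeBorelAction.exists_maximal_independent`).

*Universality.* Let `(X, μ)` be a free system and let `a : X → 2^ℕ` be a Borel injection. Starting
with any equivariant Borel map `X → Z₀`, one changes the `n`-th map around a maximal
`U`-independent Borel subset of `X` so that it takes values in `Zₙ₊₁`. As `U` is chosen large
compared with the pattern, this affects the layers below `n` only on a set of measure at most
`2⁻ⁿ`. At the same time, one writes a bit of `a x` into the new, still unrestricted data layer
(`Glues.exists_perturb`, `Tower.exists_approximations`). By Borel–Cantelli the maps converge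
almost everywhere, and all but finitely many layers of the limit record the bits of `a x`
faithfully; since every bit is recorded in infinitely many layers, the limit is injective
(`Tower.exists_embedding`).

*Minimality and disjointness.* The construction runs along the binary tree, with one set of
configurations for every node, and the flows correspond to the branches. At level `n`, the
patterns at the finitely many nodes are chosen such that every choice of configurations, one for
each node, is moved by a single element of `G` close to any other choice. This needs patterns
containing given pieces at sparse positions, such that copies centered at *arbitrary* maximal
independent sets, one for every node, have all given pieces at a common position. Random positions
do this (`exists_covering`): a tuple of centers has `k` independent chances, so it fails with a
probability exponentially small in `k`, while the number of tuples of centers that have to be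
considered is only polynomial in `k`. This works over all infinite groups. It makes every finite
product of the flows minimal, and hence the whole product (`Tower.mutuallyDisjoint`).
-/

open scoped Pointwise

/-! ### Maximal independent Borel sets -/

/-- An everywhere free action of `G` by Borel maps on a measurable space whose points are separated
by a sequence of Borel sets (given as a Borel injection into `ℕ → Bool`). -/
structure FreeBorelAction (G : Type u) (X : Type v) [Group G] [MeasurableSpace X]
    [MulAction G X] : Prop where
  measurable_smul : ∀ g : G, Measurable fun x : X => g • x
  free : ∀ (g : G) (x : X), g • x = x → g = 1
  separated : ∃ a : X → ℕ → Bool, Measurable a ∧ Function.Injective a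

/-- A set `B` is `U`-independent if distinct points of `B` are never related by an element
of `U`. -/
def Independent {G : Type u} {X : Type v} [SMul G X] [One G] (U : Finset G) (B : Set X) : Prop :=
  ∀ b ∈ B, ∀ g ∈ U, g • b ∈ B → g = 1

section Independent

theorem MeasurableSet.setOf_forall_mem {X : Type*} {ι : Type*} [MeasurableSpace X] (s : Finset ι)
    {p : ι → X → Prop} (h : ∀ i ∈ s, MeasurableSet {x | p i x}) :
    MeasurableSet {x | ∀ i ∈ s, p i x} := by
  have := Finset.measurableSet_biInter s h
  convert this using 1
  ext x
  simp

theorem MeasurableSet.setOf_exists_mem {X : Type*} {ι : Type*} [MeasurableSpace X] (s : Finset ι)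
    {p : ι → X → Prop} (h : ∀ i ∈ s, MeasurableSet {x | p i x}) :
    MeasurableSet {x | ∃ i ∈ s, p i x} := by
  have := Finset.measurableSet_biUnion s h
  convert this using 1
  ext x
  simp

variable {G : Type u} {X : Type v} [Group G] [MeasurableSpace X] [MulAction G X]

theorem FreeBorelAction.exists_cover (hX : FreeBorelAction G X) (U : Finset G) :
    ∃ C : ℕ → Set X, (∀ k, MeasurableSet (C k)) ∧ (∀ k, Independent U (C k)) ∧
      ∀ x, ∃ k, x ∈ C k := by
  classical
  obtain ⟨a, ha, hinj⟩ := hX.separated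
  -- `D p` consists of the points whose code starts with `p`, unlike the codes of the other points
  -- of `U • x`
  let D : (Σ n : ℕ, (Fin n → Bool)) → Set X := fun p =>
    {x | (∀ i : Fin p.1, a x i = p.2 i) ∧ ∀ g ∈ U, g ≠ 1 → ∃ i : Fin p.1, a (g • x) i ≠ p.2 i}
  obtain ⟨e, he⟩ := exists_surjective_nat (Σ n : ℕ, (Fin n → Bool))
  have hbit : ∀ (i : ℕ) (c : Bool) (g : G), MeasurableSet {x : X | a (g • x) i = c} :=
    fun i c g => ((measurable_pi_apply i).comp (ha.comp (hX.measurable_smul g)))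
      (measurableSet_singleton c)
  refine ⟨fun k => D (e k), fun k => ?_, fun k => ?_, fun x => ?_⟩
  · refine MeasurableSet.inter (s₁ := {x | ∀ i : Fin (e k).1, a x i = (e k).2 i})
      (s₂ := {x | ∀ g ∈ U, g ≠ 1 → ∃ i : Fin (e k).1, a (g • x) i ≠ (e k).2 i}) ?_ ?_
    · simpa using MeasurableSet.setOf_forall_mem Finset.univ
        (p := fun (i : Fin (e k).1) x => a x i = (e k).2 i)
        fun i _ => by simpa using hbit i ((e k).2 i) 1
    · refine MeasurableSet.setOf_forall_mem U fun g _ => ?_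
      by_cases h1 : g = 1
      · simp [h1]
      · simpa [h1] using MeasurableSet.setOf_exists_mem Finset.univ
          (p := fun (i : Fin (e k).1) x => a (g • x) i ≠ (e k).2 i)
          fun i _ => (hbit i ((e k).2 i) g).compl
  · intro x hx g hg hgx
    by_contra hne
    obtain ⟨i, hi⟩ := hx.2 g hg hne
    exact hi (hgx.1 i)
  · have hsep : ∀ g ∈ U, ∃ i, g ≠ 1 → a (g • x) i ≠ a x i := by
      intro g _
      by_cases h1 : g = 1
      · exact ⟨0, fun h => absurd h1 h⟩
      · have : a (g • x) ≠ a x := fun h => h1 (hX.free g x (hinj h))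
        obtain ⟨i, hi⟩ := Function.ne_iff.mp this
        exact ⟨i, fun _ => hi⟩
    choose! i hi using hsep
    obtain ⟨k, hk⟩ := he ⟨U.sup i + 1, fun j => a x j⟩
    refine ⟨k, ?_⟩
    simp only [hk]
    exact ⟨fun j => rfl, fun g hg h1 =>
      ⟨⟨i g, Nat.lt_succ_of_le (Finset.le_sup hg)⟩, hi g hg h1⟩⟩

/-- Inside every Borel set there is a maximal `U`-independent Borel set: go through a countable
cover by independent sets and add points greedily. -/
theorem FreeBorelAction.exists_maximal_independent (hX : FreeBorelAction G X) {U : Finset G}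
    (h1 : 1 ∈ U) (hinv : ∀ g ∈ U, g⁻¹ ∈ U) {M : Set X} (hM : MeasurableSet M) :
    ∃ B ⊆ M, MeasurableSet B ∧ Independent U B ∧ ∀ x ∈ M, ∃ g ∈ U, g • x ∈ B := by
  obtain ⟨C, hCm, hCi, hC⟩ := hX.exists_cover U
  let B : ℕ → Set X := fun n => Nat.rec ∅ (fun k s =>
    s ∪ {x | x ∈ M ∧ x ∈ C k ∧ ∀ g ∈ U, g • x ∉ s}) n
  have hB : ∀ k, B (k + 1) = B k ∪ {x | x ∈ M ∧ x ∈ C k ∧ ∀ g ∈ U, g • x ∉ B k} := fun _ => rfl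
  have hmono : Monotone B := monotone_nat_of_le_succ fun k => by
    rw [hB]; exact Set.subset_union_left
  have hsub : ∀ k, B k ⊆ M := by
    intro k
    induction k with
    | zero => exact Set.empty_subset _
    | succ k ih =>
      rw [hB]
      exact Set.union_subset ih fun x hx => hx.1
  have hmeas : ∀ k, MeasurableSet (B k) := by
    intro k
    induction k with
    | zero => exact MeasurableSet.empty
    | succ k ih =>
      rw [hB]
      refine ih.union (hM.inter ((hCm k).inter ?_))
      exact MeasurableSet.setOf_forall_mem U fun g _ => (hX.measurable_smul g) ih.compl
  have hind : ∀ k, Independent U (B k) := by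
    intro k
    induction k with
    | zero => intro b hb; exact hb.elim
    | succ k ih =>
      rw [hB]
      rintro b (hb | hb) g hg (hgb | hgb)
      · exact ih b hb g hg hgb
      · exact absurd (by simpa using hb) (hgb.2.2 g⁻¹ (hinv g hg))
      · exact absurd hgb (hb.2.2 g hg)
      · exact hCi k b hb.2.1 g hg hgb.2.1
  refine ⟨⋃ k, B k, Set.iUnion_subset hsub, MeasurableSet.iUnion hmeas, ?_, ?_⟩
  · intro b hb g hg hgb
    obtain ⟨k, hk⟩ := Set.mem_iUnion.mp hb
    obtain ⟨l, hl⟩ := Set.mem_iUnion.mp hgb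
    exact hind (max k l) b (hmono (le_max_left k l) hk) g hg (hmono (le_max_right k l) hl)
  · intro x hx
    obtain ⟨k, hk⟩ := hC x
    rcases Classical.em (∃ g ∈ U, g • x ∈ B k) with ⟨g, hg, hgx⟩ | h
    · exact ⟨g, hg, Set.mem_iUnion.mpr ⟨k, hgx⟩⟩
    · refine ⟨1, h1, Set.mem_iUnion.mpr ⟨k + 1, ?_⟩⟩
      rw [hB, one_smul]
      exact Or.inr ⟨hx, hk, fun g hg hgx => h ⟨g, hg, hgx⟩⟩

end Independent

/-! ### Configurations and gluing -/

/-- Configurations over `G`: every group element carries a sequence of layers, each consisting of a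
data bit and a mark bit. -/
abbrev Config (G : Type u) : Type u := G → ℕ → Bool × Bool

/-- Two letters agree on the layers below `n`. -/
def AgreeBelow (n : ℕ) (a b : ℕ → Bool × Bool) : Prop := ∀ i < n, a i = b i

theorem AgreeBelow.rfl' {n : ℕ} {a : ℕ → Bool × Bool} : AgreeBelow n a a := fun _ _ => rfl

theorem AgreeBelow.symm {n : ℕ} {a b : ℕ → Bool × Bool} (h : AgreeBelow n a b) :
    AgreeBelow n b a := fun i hi => (h i hi).symm

theorem AgreeBelow.trans {n : ℕ} {a b c : ℕ → Bool × Bool} (h : AgreeBelow n a b)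
    (h' : AgreeBelow n b c) : AgreeBelow n a c := fun i hi => (h i hi).trans (h' i hi)

theorem AgreeBelow.mono {m n : ℕ} (hmn : m ≤ n) {a b : ℕ → Bool × Bool} (h : AgreeBelow n a b) :
    AgreeBelow m a b := fun i hi => h i (hi.trans_le hmn)

/-- The left action of `G` on configurations by right translation of the argument. -/
def shift {G : Type u} [Group G] (g : G) (c : Config G) : Config G := fun h => c (h * g)

/-- The configuration that a letter-valued function displays along the orbit of `x`. -/
def orbitConfig {G : Type u} {X : Type v} [SMul G X] (ζ : X → ℕ → Bool × Bool) (x : X) :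
    Config G := fun g => ζ (g • x)

/-- `Z` is determined by the layers below `n`. -/
def DependsBelow {G : Type u} (n : ℕ) (Z : Set (Config G)) : Prop :=
  ∀ z z' : Config G, (∀ g, AgreeBelow n (z g) (z' g)) → z ∈ Z → z' ∈ Z

/-- The set `Z` of configurations is irreducible with gap `Q`, in a Borel way over `X`: suppose
that configurations `f s ∈ Z` are proposed around the points `s` of a Borel set `S`, and that
points of `S` that are related by an element of `Q` propose the same configuration of their
common orbit.  Then there is a letter-valued Borel function on `X`, with configurations in `Z`
along all orbits, that follows the proposals on `S` as far as the layers below `n` go.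

For `X = G` this is the strong irreducibility of a subshift. -/
def Glues {G : Type u} (X : Type v) [Group G] [MeasurableSpace X] [MulAction G X]
    (Q : Finset G) (n : ℕ) (Z : Set (Config G)) : Prop :=
  ∀ (S : Set X) (f : X → Config G), MeasurableSet S → Measurable f → (∀ s ∈ S, f s ∈ Z) →
    (∀ s ∈ S, ∀ q ∈ Q, q • s ∈ S → f (q • s) = shift q (f s)) →
    ∃ ζ : X → ℕ → Bool × Bool, Measurable ζ ∧ (∀ x, orbitConfig ζ x ∈ Z) ∧
      ∀ s ∈ S, AgreeBelow n (ζ s) (f s 1)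

/-- The data of a refinement step: around each point of a maximal `indep`-independent set, the
pattern `pattern` has to be displayed on the window `window`. -/
structure Block (G : Type u) where
  window : Finset G
  indep : Finset G
  pattern : Config G

/-- The configurations in `Z` whose marks in layer `n` form a maximal independent set, around each
point of which the pattern of the block is displayed in the layers below `n`. -/
def blockRefine {G : Type u} [Group G] (n : ℕ) (Z : Set (Config G)) (b : Block G) :
    Set (Config G) :=
  {z | z ∈ Z ∧ Independent b.indep {g : G | (z g n).2 = true} ∧
    (∀ g, ∃ u ∈ b.indep, (z (u * g) n).2 = true) ∧
    ∀ g, (z g n).2 = true → ∀ e ∈ b.window, AgreeBelow n (z (e * g)) (b.pattern e)}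

/-- The function `ζ` with its layer `n` overwritten by the data bit `a` and the marks `B`. -/
noncomputable def overwrite {X : Type v} (ζ : X → ℕ → Bool × Bool) (n : ℕ) (a : X → Bool)
    (B : Set X) : X → ℕ → Bool × Bool :=
  open Classical in fun x i => if i = n then (a x, decide (x ∈ B)) else ζ x i

section Basic

variable {G : Type u} {X : Type v} [Group G] [MulAction G X]

theorem shift_shift (g h : G) (c : Config G) : shift g (shift h c) = shift (g * h) c := by
  funext x
  simp [shift, mul_assoc]

theorem shift_one (c : Config G) : shift 1 c = c := by
  funext x
  simp [shift]

theorem shift_apply_one (g : G) (c : Config G) : shift g c 1 = c g := by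
  simp [shift]

theorem orbitConfig_smul (ζ : X → ℕ → Bool × Bool) (g : G) (x : X) :
    orbitConfig ζ (g • x) = shift g (orbitConfig (G := G) ζ x) := by
  funext h
  simp [orbitConfig, shift, mul_smul]

theorem overwrite_agree (ζ : X → ℕ → Bool × Bool) (n : ℕ) (a : X → Bool) (B : Set X) (x : X) :
    AgreeBelow n (overwrite ζ n a B x) (ζ x) := fun i hi => by
  simp [overwrite, hi.ne]

theorem overwrite_mark (ζ : X → ℕ → Bool × Bool) (n : ℕ) (a : X → Bool) (B : Set X) (x : X) :
    (overwrite ζ n a B x n).2 = true ↔ x ∈ B := by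
  simp [overwrite]

theorem overwrite_data (ζ : X → ℕ → Bool × Bool) (n : ℕ) (a : X → Bool) (B : Set X) (x : X) :
    (overwrite ζ n a B x n).1 = a x := by
  simp [overwrite]

theorem shift_mem_blockRefine {n : ℕ} {Z : Set (Config G)} {b : Block G}
    (hZ : ∀ g, ∀ z ∈ Z, shift g z ∈ Z) (g : G) {z : Config G} (hz : z ∈ blockRefine n Z b) :
    shift g z ∈ blockRefine n Z b := by
  obtain ⟨h0, h1, h2, h3⟩ := hz
  refine ⟨hZ g z h0, ?_, fun h => ?_, fun h hh e he => ?_⟩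
  · intro x hx u hu hux
    refine h1 (x * g) hx u hu ?_
    simpa [shift, mul_assoc] using hux
  · obtain ⟨u, hu, hu'⟩ := h2 (h * g)
    exact ⟨u, hu, by simpa [shift, mul_assoc] using hu'⟩
  · simpa [shift, mul_assoc] using h3 (h * g) hh e he

theorem dependsBelow_blockRefine {n : ℕ} {Z : Set (Config G)} (hZ : DependsBelow n Z)
    (b : Block G) :
    DependsBelow (n + 1) (blockRefine n Z b) := by
  rintro z z' h ⟨h0, h1, h2, h3⟩
  have hn : ∀ g, z g n = z' g n := fun g => h g n n.lt_succ_self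
  have hlt : ∀ g, AgreeBelow n (z g) (z' g) := fun g => (h g).mono n.le_succ
  refine ⟨hZ z z' hlt h0, ?_, ?_, fun g hg e he => ?_⟩
  · simpa only [hn] using h1
  · simpa only [hn] using h2
  · exact (hlt _).symm.trans (h3 g (by rw [hn]; exact hg) e he)

theorem orbitConfig_overwrite_mem_blockRefine {n : ℕ} {Z : Set (Config G)} (hZ : DependsBelow n Z)
    {b : Block G} {ζ : X → ℕ → Bool × Bool} (hζ : ∀ x, orbitConfig ζ x ∈ Z) (a : X → Bool)
    {B : Set X} (hB : Independent b.indep B) (hmax : ∀ x, ∃ u ∈ b.indep, u • x ∈ B)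
    (hdisp : ∀ x ∈ B, ∀ e ∈ b.window, AgreeBelow n (ζ (e • x)) (b.pattern e)) (x : X) :
    orbitConfig (overwrite ζ n a B) x ∈ blockRefine n Z b := by
  refine ⟨hZ _ _ (fun g => (overwrite_agree ζ n a B (g • x)).symm) (hζ x), ?_, fun g => ?_,
    fun g hg e he => ?_⟩
  · intro g hg u hu hug
    simp only [orbitConfig, Set.mem_ofPred_eq, overwrite_mark] at hg hug
    exact hB _ hg u hu (by simpa [mul_smul] using hug)
  · obtain ⟨u, hu, hux⟩ := hmax (g • x)
    exact ⟨u, hu, by simpa [orbitConfig, overwrite_mark, mul_smul] using hux⟩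
  · simp only [orbitConfig, overwrite_mark] at hg ⊢
    rw [mul_smul]
    exact (overwrite_agree ζ n a B _).trans (hdisp _ hg e he)

variable [MeasurableSpace X]

theorem measurable_shift (g : G) : Measurable (shift g : Config G → Config G) :=
  measurable_pi_lambda _ fun h => measurable_pi_apply (h * g)

theorem FreeBorelAction.measurable_orbitConfig (hX : FreeBorelAction G X)
    {ζ : X → ℕ → Bool × Bool} (hζ : Measurable ζ) :
    Measurable (orbitConfig ζ : X → Config G) :=
  measurable_pi_lambda _ fun g => hζ.comp (hX.measurable_smul g)

theorem measurable_overwrite {ζ : X → ℕ → Bool × Bool} (hζ : Measurable ζ) (n : ℕ) {a : X → Bool}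
    (ha : Measurable a) {B : Set X} (hB : MeasurableSet B) : Measurable (overwrite ζ n a B) := by
  classical
  refine measurable_pi_lambda _ fun i => ?_
  by_cases hi : i = n
  · simp only [overwrite, hi, if_true]
    refine ha.prodMk ?_
    refine measurable_to_bool ?_
    convert hB using 1
    ext x
    simp
  · simp only [overwrite, hi, if_false]
    exact (measurable_pi_apply i).comp hζ

theorem glues_univ : Glues (G := G) X {1} 0 Set.univ := by
  intro S f hS hf _ _
  exact ⟨fun _ _ => (false, false), measurable_const, fun _ => trivial,
    fun s _ i hi => absurd hi i.not_lt_zero⟩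

theorem Glues.mono {Q Q' : Finset G} {n : ℕ} {Z : Set (Config G)} (h : Glues X Q n Z)
    (hQ : Q ⊆ Q') : Glues X Q' n Z := fun S f hS hf hm hc =>
  h S f hS hf hm fun s hs q hq => hc s hs q (hQ hq)

theorem Glues.nonempty [Nonempty X] {Q : Finset G} {n : ℕ} {Z : Set (Config G)}
    (h : Glues X Q n Z) : Z.Nonempty := by
  obtain ⟨ζ, -, hζ, -⟩ := h ∅ (fun _ _ _ => (false, false)) MeasurableSet.empty measurable_const
    (fun s hs => hs.elim) (fun s hs => hs.elim)
  exact ⟨_, hζ (Classical.arbitrary X)⟩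

/-- Proposals on `S` that agree where they have to can be spread to all translates of `S` by a
finite set. -/
theorem FreeBorelAction.exists_spread (hX : FreeBorelAction G X) {S : Set X}
    (hS : MeasurableSet S) {f : X → Config G} (hf : Measurable f) (L : Finset G)
    (hc : ∀ s ∈ S, ∀ g ∈ L, ∀ h ∈ L, (h⁻¹ * g) • s ∈ S →
      f ((h⁻¹ * g) • s) = shift (h⁻¹ * g) (f s)) :
    ∃ F : X → Config G, Measurable F ∧ ∀ s ∈ S, ∀ g ∈ L, F (g • s) = shift g (f s) := by
  classical
  induction L using Finset.induction_on with
  | empty => exact ⟨f, hf, fun s _ g hg => absurd hg (Finset.notMem_empty g)⟩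
  | insert u L _ ih =>
    obtain ⟨F, hF, hFs⟩ := ih fun s hs g hg h hh =>
      hc s hs g (Finset.mem_insert_of_mem hg) h (Finset.mem_insert_of_mem hh)
    refine ⟨fun x => if x ∈ (fun x : X => u⁻¹ • x) ⁻¹' S then shift u (f (u⁻¹ • x)) else F x,
      Measurable.ite (hX.measurable_smul _ hS)
        ((measurable_shift u).comp (hf.comp (hX.measurable_smul _))) hF, fun s hs g hg => ?_⟩
    by_cases hgs : (u⁻¹ * g) • s ∈ S
    · have : u⁻¹ • g • s ∈ S := by rwa [smul_smul]
      simp only [Set.mem_preimage, this, if_true]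
      rw [smul_smul, hc s hs g hg u (Finset.mem_insert_self u L) hgs, shift_shift]
      simp
    · have h' : u⁻¹ • g • s ∉ S := by rwa [smul_smul]
      simp only [Set.mem_preimage, h', if_false]
      rcases Finset.mem_insert.mp hg with rfl | hgL
      · simp [hs] at hgs
      · exact hFs s hs g hgL

theorem FreeBorelAction.measurableSet_smul (hX : FreeBorelAction G X) (L : Finset G) {S : Set X}
    (hS : MeasurableSet S) : MeasurableSet ((L : Set G) • S) := by
  have := MeasurableSet.setOf_exists_mem L (p := fun g (x : X) => g⁻¹ • x ∈ S)
    fun g _ => hX.measurable_smul g⁻¹ hS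
  convert this using 1
  ext x
  constructor
  · rintro ⟨g, hg, s, hs, rfl⟩
    exact ⟨g, hg, by simpa using hs⟩
  · rintro ⟨g, hg, hs⟩
    exact ⟨g, hg, g⁻¹ • x, hs, by simp⟩

/-- The pattern `P` can be proposed consistently on the translates by `E` of an independent
set. -/
theorem FreeBorelAction.exists_spread_pattern (hX : FreeBorelAction G X) {B : Set X}
    (hB : MeasurableSet B) {E U : Finset G} (hBU : Independent U B)
    (hU : ∀ e ∈ E, ∀ e' ∈ E, e'⁻¹ * e ∈ U) (P : Config G) :
    ∃ F : X → Config G, Measurable F ∧ ∀ s ∈ B, ∀ g ∈ E, F (g • s) = shift g P := by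
  refine hX.exists_spread hB (measurable_const (a := P)) E fun s hs g hg h hh hgh => ?_
  rw [hBU s hs _ (hU g hg h hh) hgh, shift_one]

end Basic

/-! ### Refinement by a block -/

/-- A finite set that contains `1` and is closed under inversion. -/
def IsSymmWithOne {G : Type u} [Group G] (Q : Finset G) : Prop := 1 ∈ Q ∧ ∀ g ∈ Q, g⁻¹ ∈ Q

/-- The independence in the block is strong enough to keep different copies of the window apart, as
seen by the gap `Q`. -/
structure Block.Compatible {G : Type u} [Group G] (b : Block G) (Q : Finset G) : Prop where
  symm : IsSymmWithOne b.indep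
  apart : ∀ e ∈ b.window, ∀ e' ∈ b.window, ∀ q ∈ Q, e'⁻¹ * q * e ∈ b.indep

section Step

variable {G : Type u} {X : Type v} [Group G] [MulAction G X] [MeasurableSpace X]

/-- Spread the proposals to a neighborhood of `S`, without losing consistency. -/
theorem FreeBorelAction.exists_thicken (hX : FreeBorelAction G X) {S : Set X}
    (hS : MeasurableSet S) {f : X → Config G} (hf : Measurable f) {A N Q : Finset G}
    (h1 : 1 ∈ N) (hA1 : 1 ∈ A) (hQ : ∀ a ∈ A, ∀ u ∈ N, ∀ v ∈ N, v⁻¹ * a * u ∈ Q)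
    (hc : ∀ s ∈ S, ∀ q ∈ Q, q • s ∈ S → f (q • s) = shift q (f s)) :
    ∃ F : X → Config G, Measurable F ∧ (∀ s ∈ S, F s = f s) ∧
      (∀ x ∈ (N : Set G) • S, ∃ g, ∃ s ∈ S, F x = shift g (f s)) ∧
      ∀ x ∈ (N : Set G) • S, ∀ a ∈ A, a • x ∈ (N : Set G) • S → F (a • x) = shift a (F x) := by
  obtain ⟨F, hF, hFs⟩ := hX.exists_spread hS hf N fun s hs g hg h hh hgh =>
    hc s hs _ (by simpa using hQ 1 hA1 g hg h hh) hgh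
  refine ⟨F, hF, fun s hs => by simpa [shift_one] using hFs s hs 1 h1, ?_, ?_⟩
  · rintro _ ⟨u, hu, s, hs, rfl⟩
    exact ⟨u, s, hs, hFs s hs u hu⟩
  · rintro _ ⟨u, hu, s, hs, rfl⟩ a ha ⟨v, hv, s', hs', hvs⟩
    have hvs' : v • s' = a • u • s := hvs
    have hs'' : s' = (v⁻¹ * a * u) • s := by
      rw [mul_smul, mul_smul, ← hvs', inv_smul_smul]
    change F (a • u • s) = shift a (F (u • s))
    rw [← hvs', hFs s' hs' v hv, hs'', hc s hs _ (hQ a ha u hu v hv) (hs'' ▸ hs'), hFs s hs u hu,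
      shift_shift, shift_shift]
    simp [mul_assoc]

/-- Irreducibility passes to the refinement by a block, with a larger gap. -/
theorem glues_blockRefine [DecidableEq G] (hX : FreeBorelAction G X) {Q : Finset G} {n : ℕ}
    {Z : Set (Config G)} (hZ : Glues X Q n Z) (hdep : DependsBelow n Z)
    (hinv : ∀ g, ∀ z ∈ Z, shift g z ∈ Z) (hQ : IsSymmWithOne Q) {b : Block G}
    (hb : b.Compatible Q) (hP : b.pattern ∈ Z) {A Q' : Finset G} (hA : IsSymmWithOne A)
    (hQA : Q ⊆ A) (hEA : b.window ⊆ A) (hUA : b.indep ⊆ A)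
    (hQ' : ∀ a ∈ A, ∀ u ∈ A * A * A, ∀ v ∈ A * A * A, v⁻¹ * a * u ∈ Q') :
    Glues X Q' (n + 1) (blockRefine n Z b) := by
  classical
  obtain ⟨E, U, P⟩ := b
  obtain ⟨⟨hU1, hUinv⟩, hUap⟩ := hb
  obtain ⟨hA1, hAinv⟩ := hA
  obtain ⟨hQ1, hQinv⟩ := hQ
  simp only at hU1 hUinv hUap hP hEA hUA
  intro S f hS hf hmem hc
  have h1A3 : (1 : G) ∈ A * A * A :=
    Finset.mem_mul.mpr ⟨1, Finset.mem_mul.mpr ⟨1, hA1, 1, hA1, one_mul 1⟩, 1, hA1, one_mul 1⟩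
  obtain ⟨F, hF, hFS, hFx, hFc⟩ := hX.exists_thicken hS hf h1A3 hA1 hQ' hc
  set S3 : Set X := ((A * A * A : Finset G) : Set G) • S with hS3
  set S2 : Set X := ((A * A : Finset G) : Set G) • S with hS2
  have hS3m : MeasurableSet S3 := hX.measurableSet_smul _ hS
  have hS2m : MeasurableSet S2 := hX.measurableSet_smul _ hS
  have hSS2 : S ⊆ S2 := fun s hs =>
    ⟨1, Finset.mem_coe.mpr (Finset.mem_mul.mpr ⟨1, hA1, 1, hA1, one_mul 1⟩), s, hs, one_smul G s⟩
  have hAAS : ∀ a ∈ A, ∀ a' ∈ A, ∀ s ∈ S, a • a' • s ∈ S2 := fun a ha a' ha' s hs =>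
    ⟨a * a', Finset.mem_coe.mpr (Finset.mul_mem_mul ha ha'), s, hs, mul_smul a a' s⟩
  have hAS2 : ∀ a ∈ A, ∀ x ∈ S2, a • x ∈ S3 := by
    rintro a ha _ ⟨u, hu, s, hs, rfl⟩
    refine ⟨a * u, ?_, s, hs, mul_smul a u s⟩
    rw [mul_assoc]
    exact Finset.mem_coe.mpr (Finset.mul_mem_mul ha hu)
  have hS23 : S2 ⊆ S3 := fun x hx => by simpa using hAS2 1 hA1 x hx
  have hFZ : ∀ x ∈ S3, F x ∈ blockRefine n Z ⟨E, U, P⟩ := by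
    intro x hx
    obtain ⟨g, s, hs, h⟩ := hFx x hx
    rw [h]
    exact shift_mem_blockRefine hinv g (hmem s hs)
  -- `B₁` is the set of marks that are already proposed near `S`
  set B₁ : Set X := {x | x ∈ S3 ∧ (F x 1 n).2 = true} with hB₁
  have hB₁m : MeasurableSet B₁ := by
    refine hS3m.inter ?_
    have : Measurable fun x => (F x 1 n).2 :=
      measurable_snd.comp ((measurable_pi_apply n).comp ((measurable_pi_apply 1).comp hF))
    exact this (measurableSet_singleton true)
  have hB₁i : Independent U B₁ := by
    rintro x ⟨hx, hx1⟩ u hu ⟨hux, hux1⟩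
    rw [hFc x hx u (hUA hu) hux, shift_apply_one] at hux1
    exact (hFZ x hx).2.1 1 hx1 u hu (by simpa using hux1)
  obtain ⟨B₂, hB₂M, hB₂m, hB₂i, hB₂max⟩ := hX.exists_maximal_independent hU1 hUinv
    (M := {x | x ∈ S2ᶜ ∧ ∀ u ∈ U, u • x ∉ B₁})
    (hS2m.compl.inter (MeasurableSet.setOf_forall_mem U fun u _ =>
      hX.measurable_smul u hB₁m.compl))
  set B : Set X := B₁ ∪ B₂ with hB
  have hBm : MeasurableSet B := hB₁m.union hB₂m
  have hBi : Independent U B := by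
    rintro x (hx | hx) u hu (hux | hux)
    · exact hB₁i x hx u hu hux
    · exact absurd (by simpa using hx) ((hB₂M hux).2 u⁻¹ (hUinv u hu))
    · exact absurd hux ((hB₂M hx).2 u hu)
    · exact hB₂i x hx u hu hux
  have hBmax : ∀ x, ∃ u ∈ U, u • x ∈ B := by
    intro x
    by_cases hx : x ∈ S2
    · obtain ⟨u, hu, hux⟩ := (hFZ x (hS23 hx)).2.2.1 1
      refine ⟨u, hu, Or.inl ⟨hAS2 u (hUA hu) x hx, ?_⟩⟩
      rw [hFc x (hS23 hx) u (hUA hu) (hAS2 u (hUA hu) x hx), shift_apply_one]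
      simpa using hux
    · by_cases h : ∀ u ∈ U, u • x ∉ B₁
      · obtain ⟨u, hu, hux⟩ := hB₂max x ⟨hx, h⟩
        exact ⟨u, hu, Or.inr hux⟩
      · push Not at h
        obtain ⟨u, hu, hux⟩ := h
        exact ⟨u, hu, Or.inl hux⟩
  have hBS2 : ∀ x ∈ B, x ∈ S2 → (F x 1 n).2 = true := by
    rintro x (hx | hx) h2
    · exact hx.2
    · exact absurd h2 (hB₂M hx).1
  have hEU : ∀ e ∈ E, ∀ e' ∈ E, e'⁻¹ * e ∈ U := fun e he e' he' => by
    simpa using hUap e he e' he' 1 hQ1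
  obtain ⟨F₂, hF₂, hF₂s⟩ := hX.exists_spread_pattern hBm hBi hEU P
  set T : Set X := S ∪ (E : Set G) • (B ∩ S2) with hT
  have hTm : MeasurableSet T := hS.union (hX.measurableSet_smul E (hBm.inter hS2m))
  have hT3 : T ⊆ S3 := by
    rintro x (hx | ⟨e, he, y, hy, rfl⟩)
    · exact hS23 (hSS2 hx)
    · exact hAS2 e (hEA he) y hy.2
  -- on `T` the proposals of `F` are followed, on the other copies of the window the pattern `P`;
  -- the points of `T` are not related by `Q` to copies of the window away from `S`
  have hTclosed : ∀ x ∈ T, ∀ q ∈ Q, ∀ y ∈ B, ∀ e ∈ E, q • x = e • y → y ∈ S2 := by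
    rintro x (hx | ⟨e', he', y', hy', rfl⟩) q hq y hy e he h
    · have : y = e⁻¹ • q • x := by rw [h, inv_smul_smul]
      rw [this]
      exact hAAS _ (hAinv e (hEA he)) q (hQA hq) x hx
    · have h' : y = (e⁻¹ * q * e') • y' := by
        change q • e' • y' = e • y at h
        rw [mul_smul, mul_smul, h, inv_smul_smul]
      have h1 := hBi y' hy'.1 _ (hUap e' he' e he q hq) (h' ▸ hy)
      rw [h1, one_smul] at h'
      exact h' ▸ hy'.2
  obtain ⟨ζ, hζm, hζZ, hζ⟩ := hZ (S ∪ (E : Set G) • B) (fun x => if x ∈ T then F x else F₂ x)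
    (hS.union (hX.measurableSet_smul E hBm)) (Measurable.ite hTm hF hF₂)
    (by
      intro x hx
      by_cases hxT : x ∈ T
      · simp only [hxT, if_true]
        exact (hFZ x (hT3 hxT)).1
      · simp only [hxT, if_false]
        rcases hx with hx | ⟨e, he, y, hy, rfl⟩
        · exact absurd (Or.inl hx) hxT
        · have := hF₂s y hy e he
          simp only [this]
          exact hinv _ _ hP)
    (by
      intro x hx q hq hqx
      have key : ∀ x ∈ S ∪ (E : Set G) • B, x ∉ T → ∃ e ∈ E, ∃ y ∈ B, y ∉ S2 ∧ x = e • y := by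
        rintro x (hx | ⟨e, he, y, hy, rfl⟩) hxT
        · exact absurd (Or.inl hx) hxT
        · exact ⟨e, he, y, hy, fun h2 => hxT (Or.inr ⟨e, he, y, ⟨hy, h2⟩, rfl⟩), rfl⟩
      by_cases hxT : x ∈ T
      · by_cases hqxT : q • x ∈ T
        · simp only [hxT, hqxT, if_true]
          exact hFc x (hT3 hxT) q (hQA hq) (hT3 hqxT)
        · obtain ⟨e, he, y, hy, hy2, h⟩ := key _ hqx hqxT
          exact absurd (hTclosed x hxT q hq y hy e he h) hy2
      · obtain ⟨e, he, y, hy, hy2, rfl⟩ := key _ hx hxT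
        by_cases hqxT : q • e • y ∈ T
        · exact absurd (hTclosed _ hqxT q⁻¹ (hQinv q hq) y hy e he (inv_smul_smul _ _)) hy2
        · obtain ⟨e', he', y', hy', -, h⟩ := key _ hqx hqxT
          simp only [hxT, hqxT, if_false]
          have h' : y' = (e'⁻¹ * q * e) • y := by
            rw [mul_smul, mul_smul, h, inv_smul_smul]
          have h1 := hBi y hy _ (hUap e he e' he' q hq) (h' ▸ hy')
          have h2 : e' = q * e := by
            rw [mul_assoc, inv_mul_eq_one] at h1
            exact h1
          rw [h1, one_smul] at h'
          rw [h, hF₂s y' hy' e' he', hF₂s y hy e he, shift_shift, h2])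
  have hfn : Measurable fun x => (f x 1 n).1 :=
    measurable_fst.comp ((measurable_pi_apply n).comp ((measurable_pi_apply 1).comp hf))
  refine ⟨overwrite ζ n (fun x => (f x 1 n).1) B, measurable_overwrite hζm n hfn hBm, fun x => ?_,
    fun s hs i hi => ?_⟩
  · refine orbitConfig_overwrite_mem_blockRefine hdep hζZ _ hBi hBmax (fun y hy e he => ?_) x
    have hmemS : e • y ∈ S ∪ (E : Set G) • B := Or.inr ⟨e, he, y, hy, rfl⟩
    have h := hζ _ hmemS
    by_cases hyS : e • y ∈ T
    · simp only [hyS, if_true] at h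
      have hy2 : y ∈ S2 := hTclosed _ hyS 1 hQ1 y hy e he (one_smul G _)
      rw [hFc y (hS23 hy2) e (hEA he) (hT3 hyS), shift_apply_one] at h
      refine h.trans ?_
      have := (hFZ y (hS23 hy2)).2.2.2 1 (hBS2 y hy hy2) e he
      simpa using this
    · simp only [hyS, if_false] at h
      rwa [hF₂s y hy e he, shift_apply_one] at h
  · have hsT : s ∈ T := Or.inl hs
    rcases Nat.lt_succ_iff_lt_or_eq.mp hi with hi' | rfl
    · rw [overwrite_agree ζ n _ B s i hi', hζ s (Or.inl hs) i hi']
      simp only [hsT, if_true, hFS s hs]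
    · refine Prod.ext (overwrite_data _ _ _ _ _) ?_
      rw [Bool.eq_iff_iff, overwrite_mark, ← hFS s hs]
      exact ⟨fun h => hBS2 s h (hSS2 hs), fun h => Or.inl ⟨hS23 (hSS2 hs), h⟩⟩

/-- A function with configurations in `Z` can be made to have its configurations in the refinement
of `Z` by a block, with prescribed data bits in layer `n`, at the cost of changing the layers below
`n` on few translates of an independent set. -/
theorem Glues.exists_perturb [DecidableEq G] (hX : FreeBorelAction G X) {Q : Finset G} {n : ℕ}
    {Z : Set (Config G)} (hZ : Glues X Q n Z) (hdep : DependsBelow n Z)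
    (hinv : ∀ g, ∀ z ∈ Z, shift g z ∈ Z) (hQ : IsSymmWithOne Q) {b : Block G}
    (hb : b.Compatible Q) (hP : b.pattern ∈ Z) {ζ : X → ℕ → Bool × Bool} (hζm : Measurable ζ)
    (hζ : ∀ x, orbitConfig ζ x ∈ Z) {a : X → Bool} (ha : Measurable a) :
    ∃ (ζ' : X → ℕ → Bool × Bool) (B : Set X), Measurable ζ' ∧ MeasurableSet B ∧
      (∀ x, orbitConfig ζ' x ∈ blockRefine n Z b) ∧ Independent b.indep B ∧
      (∀ x, (ζ' x n).1 = a x) ∧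
      ∀ x, x ∉ ((Q * b.window : Finset G) : Set G) • B → AgreeBelow n (ζ' x) (ζ x) := by
  classical
  obtain ⟨E, U, P⟩ := b
  obtain ⟨⟨hU1, hUinv⟩, hUap⟩ := hb
  obtain ⟨hQ1, hQinv⟩ := hQ
  simp only at hU1 hUinv hUap hP
  obtain ⟨B, -, hBm, hBi, hBmax⟩ := hX.exists_maximal_independent hU1 hUinv MeasurableSet.univ
  have hEU : ∀ e ∈ E, ∀ e' ∈ E, e'⁻¹ * e ∈ U := fun e he e' he' => by
    simpa using hUap e he e' he' 1 hQ1
  obtain ⟨F, hF, hFs⟩ := hX.exists_spread_pattern hBm hBi hEU P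
  set T : Set X := (E : Set G) • B with hT
  have hTm : MeasurableSet T := hX.measurableSet_smul E hBm
  set V : Set X := ((Q * E : Finset G) : Set G) • B with hV
  have hVm : MeasurableSet V := hX.measurableSet_smul _ hBm
  have hTV : ∀ x ∈ T, ∀ q ∈ Q, q • x ∈ V := by
    rintro _ ⟨e, he, y, hy, rfl⟩ q hq
    exact ⟨q * e, Finset.mem_coe.mpr (Finset.mul_mem_mul hq he), y, hy, mul_smul q e y⟩
  obtain ⟨ξ, hξm, hξZ, hξ⟩ := hZ (T ∪ Vᶜ) (fun x => if x ∈ T then F x else orbitConfig ζ x)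
    (hTm.union hVm.compl) (Measurable.ite hTm hF (hX.measurable_orbitConfig hζm))
    (by
      intro x _
      by_cases hxT : x ∈ T
      · simp only [hxT, if_true]
        obtain ⟨e, he, y, hy, rfl⟩ := hxT
        have := hFs y hy e he
        simp only [this]
        exact hinv _ _ hP
      · simp only [hxT, if_false]
        exact hζ x)
    (by
      intro x hx q hq hqx
      by_cases hxT : x ∈ T
      · rcases hqx with hqxT | hqxV
        · simp only [hxT, hqxT, if_true]
          obtain ⟨e, he, y, hy, rfl⟩ := hxT
          obtain ⟨e', he', y', hy', h⟩ := hqxT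
          change e' • y' = q • e • y at h
          have h' : y' = (e'⁻¹ * q * e) • y := by
            rw [mul_smul, mul_smul, ← h, inv_smul_smul]
          have h1 := hBi y hy _ (hUap e he e' he' q hq) (h' ▸ hy')
          have h2 : e' = q * e := by
            rw [mul_assoc, inv_mul_eq_one] at h1
            exact h1
          change F (q • e • y) = shift q (F (e • y))
          rw [← h, hFs y' hy' e' he', hFs y hy e he, shift_shift, h2]
        · exact absurd (hTV x hxT q hq) hqxV
      · by_cases hqxT : q • x ∈ T
        · rcases hx with hx | hx
          · exact absurd hx hxT
          · exact absurd (by simpa using hTV _ hqxT q⁻¹ (hQinv q hq)) hx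
        · simp only [hxT, hqxT, if_false]
          exact orbitConfig_smul ζ q x)
  refine ⟨overwrite ξ n a B, B, measurable_overwrite hξm n ha hBm, hBm, fun x => ?_, hBi,
    overwrite_data ξ n a B, fun x hx => ?_⟩
  · refine orbitConfig_overwrite_mem_blockRefine hdep hξZ a hBi (fun x => hBmax x trivial)
      (fun y hy e he => ?_) x
    have hyT : e • y ∈ T := ⟨e, he, y, hy, rfl⟩
    have h := hξ _ (Or.inl hyT)
    simp only [hyT, if_true] at h
    rwa [hFs y hy e he, shift_apply_one] at h
  · have hxT : x ∉ T := fun h => hx (one_smul G x ▸ hTV x h 1 hQ1)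
    have h := hξ x (Or.inr hx)
    simp only [hxT, if_false] at h
    refine (overwrite_agree ξ n a B x).trans (h.trans ?_)
    simp only [orbitConfig, one_smul]
    exact AgreeBelow.rfl'

end Step

/-! ### Counting functions that avoid patterns -/

section Counting

/-- The proportion of the functions `θ : V → A` that miss the pattern `π f` on `C f` for every
`f ∈ F` is at most `(1 - |A|⁻ʳ) ^ |F|`, if the sets `C f` are disjoint and have at most `r`
elements: every set `C f` contributes an independent chance `|A|⁻ʳ` to see the pattern. -/
theorem card_avoid_le {V A ι : Type*} [Fintype V] [DecidableEq V] [Fintype A] [DecidableEq A]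
    [Nonempty A] [DecidableEq ι] (F : Finset ι) (C : ι → Finset V) (π : ι → V → A) (r : ℕ)
    (hr : ∀ f ∈ F, (C f).card ≤ r)
    (hdisj : ∀ f ∈ F, ∀ f' ∈ F, f ≠ f' → Disjoint (C f) (C f')) :
    ((Finset.univ.filter fun θ : V → A => ∀ f ∈ F, ∃ v ∈ C f, θ v ≠ π f v).card : ℝ) ≤
      (1 - ((Fintype.card A : ℝ) ^ r)⁻¹) ^ F.card * (Fintype.card A : ℝ) ^ Fintype.card V := by
  have ha : (1 : ℝ) ≤ Fintype.card A := by exact_mod_cast Fintype.card_pos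
  have har : (1 : ℝ) ≤ (Fintype.card A : ℝ) ^ r := one_le_pow₀ ha
  have hδ : 0 ≤ 1 - ((Fintype.card A : ℝ) ^ r)⁻¹ := sub_nonneg.mpr (inv_le_one_of_one_le₀ har)
  induction F using Finset.induction_on with
  | empty =>
    simp
  | insert f F hf ih =>
    have ih' := ih (fun g hg => hr g (Finset.mem_insert_of_mem hg)) fun g hg g' hg' =>
      hdisj g (Finset.mem_insert_of_mem hg) g' (Finset.mem_insert_of_mem hg')
    set S := Finset.univ.filter fun θ : V → A => ∀ f ∈ F, ∃ v ∈ C f, θ v ≠ π f v with hS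
    set T := S.filter fun θ : V → A => ∀ v ∈ C f, θ v = π f v with hT
    have hsplit : (Finset.univ.filter fun θ : V → A =>
        ∀ g ∈ insert f F, ∃ v ∈ C g, θ v ≠ π g v) = S \ T := by
      ext θ
      simp only [hS, hT, Finset.mem_sdiff, Finset.mem_filter, Finset.mem_univ, true_and,
        Finset.forall_mem_insert]
      constructor
      · rintro ⟨⟨v, hv, hne⟩, h⟩
        exact ⟨h, fun h' => hne (h'.2 v hv)⟩
      · rintro ⟨h, h'⟩
        refine ⟨?_, h⟩
        by_contra hcon
        push Not at hcon
        exact h' ⟨h, hcon⟩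
    -- overwriting a function by the pattern on `C f` loses at most `|A| ^ r` choices
    have hST : S.card ≤ T.card * Fintype.card A ^ (C f).card := by
      have : Fintype.card A ^ (C f).card = (Finset.univ : Finset (C f → A)).card := by simp
      rw [this, ← Finset.card_product]
      refine Finset.card_le_card_of_injOn
        (fun θ => (fun v => if v ∈ C f then π f v else θ v, fun v => θ v)) ?_ ?_
      · intro θ hθ
        simp only [hS, Finset.coe_filter, Finset.mem_univ, true_and, Set.mem_ofPred_eq] at hθ
        simp only [hT, hS, Finset.coe_product, Finset.coe_univ, Set.mem_prod, Finset.mem_coe,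
          Finset.mem_filter, Finset.mem_univ, true_and, Set.mem_univ, and_true]
        refine ⟨fun g hg => ?_, fun v hv => by simp [hv]⟩
        obtain ⟨v, hv, hne⟩ := hθ g hg
        refine ⟨v, hv, ?_⟩
        have hvf : v ∉ C f := fun hvf => Finset.disjoint_left.mp
          (hdisj f (Finset.mem_insert_self f F) g (Finset.mem_insert_of_mem hg)
            (fun h => hf (h ▸ hg))) hvf hv
        simpa [hvf] using hne
      · intro θ _ θ' _ h
        simp only [Prod.mk.injEq] at h
        funext v
        by_cases hv : v ∈ C f
        · exact congrFun h.2 ⟨v, hv⟩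
        · have := congrFun h.1 v
          simpa [hv] using this
    have hST' : (S.card : ℝ) ≤ T.card * (Fintype.card A : ℝ) ^ r := by
      calc (S.card : ℝ) ≤ T.card * (Fintype.card A : ℝ) ^ (C f).card := by exact_mod_cast hST
        _ ≤ _ := by
          gcongr
          · exact hr f (Finset.mem_insert_self f F)
    have hTS : T ⊆ S := Finset.filter_subset _ _
    have hpos : (0 : ℝ) < (Fintype.card A : ℝ) ^ r := by positivity
    rw [hsplit, Finset.cast_card_sdiff hTS, Finset.card_insert_of_notMem hf, pow_succ]
    have h1 : (S.card : ℝ) * ((Fintype.card A : ℝ) ^ r)⁻¹ ≤ T.card := by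
      rw [← div_eq_mul_inv, div_le_iff₀ hpos]
      exact hST'
    calc (S.card : ℝ) - T.card ≤ S.card * (1 - ((Fintype.card A : ℝ) ^ r)⁻¹) := by linarith
      _ ≤ ((1 - ((Fintype.card A : ℝ) ^ r)⁻¹) ^ F.card * (Fintype.card A : ℝ) ^ Fintype.card V)
          * (1 - ((Fintype.card A : ℝ) ^ r)⁻¹) := by gcongr
      _ = _ := by ring

/-- Union bound for `card_avoid_le`: if there are few constraints `w ∈ W`, some function satisfies
each of them, i.e. displays one of its patterns. -/
theorem exists_display {V A ι W : Type*} [Fintype V] [DecidableEq V] [Fintype A] [DecidableEq A]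
    [Nonempty A] [DecidableEq ι] (W' : Finset W) (F : Finset ι) (C : W → ι → Finset V)
    (π : W → ι → V → A) (r : ℕ) (hr : ∀ w ∈ W', ∀ f ∈ F, (C w f).card ≤ r)
    (hdisj : ∀ w ∈ W', ∀ f ∈ F, ∀ f' ∈ F, f ≠ f' → Disjoint (C w f) (C w f'))
    (hlt : (W'.card : ℝ) * (1 - ((Fintype.card A : ℝ) ^ r)⁻¹) ^ F.card < 1) :
    ∃ θ : V → A, ∀ w ∈ W', ∃ f ∈ F, ∀ v ∈ C w f, θ v = π w f v := by
  classical
  by_contra hcon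
  push Not at hcon
  have hcover : (Finset.univ : Finset (V → A)) ⊆ W'.biUnion fun w =>
      Finset.univ.filter fun θ : V → A => ∀ f ∈ F, ∃ v ∈ C w f, θ v ≠ π w f v := by
    intro θ _
    obtain ⟨w, hw, h⟩ := hcon θ
    simp only [Finset.mem_biUnion, Finset.mem_filter, Finset.mem_univ, true_and]
    exact ⟨w, hw, h⟩
  have h1 := (Finset.card_le_card hcover).trans Finset.card_biUnion_le
  have h2 : ((Finset.univ : Finset (V → A)).card : ℝ) ≤
      ∑ w ∈ W', ((1 - ((Fintype.card A : ℝ) ^ r)⁻¹) ^ F.card *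
        (Fintype.card A : ℝ) ^ Fintype.card V) := by
    refine le_trans (by exact_mod_cast h1) (?_ : ((∑ w ∈ W', (Finset.univ.filter
      fun θ : V → A => ∀ f ∈ F, ∃ v ∈ C w f, θ v ≠ π w f v).card : ℕ) : ℝ) ≤ _)
    rw [Nat.cast_sum]
    exact Finset.sum_le_sum fun w hw => card_avoid_le F (C w) (π w) r (hr w hw) (hdisj w hw)
  rw [Finset.sum_const, nsmul_eq_mul, Finset.card_univ, Fintype.card_fun, ← mul_assoc] at h2
  push_cast at h2
  have ha : (0 : ℝ) < (Fintype.card A : ℝ) ^ Fintype.card V := by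
    have : (0 : ℝ) < Fintype.card A := by exact_mod_cast Fintype.card_pos
    positivity
  nlinarith

end Counting

/-! ### Covering by sparse labellings -/

section Covering

variable {G : Type u} [Group G]

theorem exists_separated [Infinite G] [DecidableEq G] (Q : Finset G) (k : ℕ) :
    ∃ F : Finset G, F.card = k ∧
      ∀ f ∈ F, ∀ f' ∈ F, ∀ q ∈ Q, ∀ q' ∈ Q, q * f = q' * f' → f = f' := by
  induction k with
  | zero => exact ⟨∅, rfl, by simp⟩
  | succ k ih =>
    obtain ⟨F, hF, hsep⟩ := ih
    obtain ⟨x, hx⟩ := Infinite.exists_notMem_finset (F ∪ Q⁻¹ * Q * F)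
    simp only [Finset.mem_union, not_or] at hx
    have key : ∀ f ∈ F, ∀ q ∈ Q, ∀ q' ∈ Q, q * x ≠ q' * f := by
      intro f hf q hq q' hq' h
      refine hx.2 ?_
      have : x = q⁻¹ * q' * f := by rw [mul_assoc, ← h, inv_mul_cancel_left]
      rw [this]
      exact Finset.mul_mem_mul (Finset.mul_mem_mul (Finset.inv_mem_inv hq) hq') hf
    refine ⟨insert x F, by rw [Finset.card_insert_of_notMem hx.1, hF], ?_⟩
    intro f hf f' hf' q hq q' hq' h
    rcases Finset.mem_insert.mp hf with rfl | hfF <;>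
      rcases Finset.mem_insert.mp hf' with rfl | hfF'
    · rfl
    · exact absurd h (key f' hfF' q hq q' hq')
    · exact absurd h.symm (key f hfF q' hq' q hq)
    · exact hsep f hfF f' hfF' q hq q' hq' h

/-- Given sets `B j` that are syndetic with constants `U j`, walk through them, starting at `1` and
ending in `B 0`: `b j = w j * b (j + 1)`. -/
theorem exists_walk {m : ℕ} (U : Fin m → Finset G) (B : Fin m → Set G)
    (h : ∀ j g, ∃ u ∈ U j, u * g ∈ B j) :
    ∃ (w : Fin m → G) (b : Fin (m + 1) → G), ∀ j, w j ∈ U j ∧ b j.castSucc ∈ B j ∧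
      b j.castSucc = w j * b j.succ := by
  induction m with
  | zero => exact ⟨fun _ => 1, fun _ => 1, fun j => j.elim0⟩
  | succ m ih =>
    obtain ⟨w, b, hwb⟩ := ih (fun j => U j.succ) (fun j => B j.succ) fun j g => h j.succ g
    obtain ⟨u, hu, hub⟩ := h 0 (b 0)
    refine ⟨Fin.cons u w, Fin.cons (u * b 0) b, fun j => ?_⟩
    refine Fin.cases ?_ (fun j => ?_) j
    · exact ⟨hu, hub, rfl⟩
    · exact hwb j

theorem partialProd_mul_eq {m : ℕ} {w : Fin m → G} {b : Fin (m + 1) → G}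
    (h : ∀ j, b j.castSucc = w j * b j.succ) (j : Fin (m + 1)) :
    Fin.partialProd w j * b j = b 0 := by
  induction j using Fin.induction with
  | zero => simp
  | succ j ih => rw [Fin.partialProd_succ, mul_assoc, ← h, ih]

/-- The regions in which patterns are placed: region `j + 1` contains all points that can be reached
from region `j` by a step of the walk through syndetic sets with constant `H`. -/
def region [DecidableEq G] (H : Finset G → Finset G) (F : Finset G) : ℕ → Finset G
  | 0 => F
  | j + 1 => region H F j * H (region H F j)

theorem partialProd_mem_region [DecidableEq G] {H : Finset G → Finset G} {F : Finset G} {m : ℕ}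
    {w : Fin m → G} (hw : ∀ j : Fin m, w j ∈ H (region H F j)) {f : G} (hf : f ∈ F)
    (j : Fin (m + 1)) : f * Fin.partialProd w j ∈ region H F j := by
  induction j using Fin.induction with
  | zero => simpa [region] using hf
  | succ j ih =>
    rw [Fin.partialProd_succ, ← mul_assoc]
    exact Finset.mul_mem_mul ih (hw j)

theorem region_nonempty [DecidableEq G] {H : Finset G → Finset G} (hne : ∀ R, (H R).Nonempty)
    {F : Finset G} (hF : F.Nonempty) (j : ℕ) : (region H F j).Nonempty := by
  induction j with
  | zero => exact hF
  | succ j ih => exact ih.mul (hne _)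

theorem card_region_le [DecidableEq G] {H : Finset G → Finset G} {κ : ℕ} (hκ : 1 ≤ κ)
    (hne : ∀ R, (H R).Nonempty) (hH : ∀ R, R.Nonempty → (H R).card ≤ κ * R.card ^ 2)
    {F : Finset G} (hF : 1 ≤ F.card) (j : ℕ) :
    (region H F j).card ≤ (κ * F.card) ^ 4 ^ j := by
  have h1 : 1 ≤ κ * F.card := Nat.mul_pos hκ hF
  induction j with
  | zero => simpa [region] using Nat.le_mul_of_pos_left F.card hκ
  | succ j ih =>
    have hκ' : κ ≤ (κ * F.card) ^ 4 ^ j :=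
      (Nat.le_mul_of_pos_right κ hF).trans (Nat.le_self_pow (by positivity) _)
    calc (region H F (j + 1)).card ≤ (region H F j).card * (H (region H F j)).card :=
          Finset.card_mul_le
      _ ≤ (region H F j).card * (κ * (region H F j).card ^ 2) := by
        gcongr
        exact hH _ (region_nonempty hne (Finset.card_pos.mp hF) j)
      _ ≤ (κ * F.card) ^ 4 ^ j * ((κ * F.card) ^ 4 ^ j * ((κ * F.card) ^ 4 ^ j) ^ 2) := by gcongr
      _ = (κ * F.card) ^ 4 ^ (j + 1) := by ring

theorem card_step_le [DecidableEq G] {H : Finset G → Finset G} {κ : ℕ} (hκ : 1 ≤ κ)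
    (hne : ∀ R, (H R).Nonempty) (hH : ∀ R, R.Nonempty → (H R).card ≤ κ * R.card ^ 2)
    {F : Finset G} (hF : 1 ≤ F.card) {j m : ℕ}
    (hj : j ≤ m) : (H (region H F j)).card ≤ (κ * F.card) ^ (3 * 4 ^ m) := by
  have h1 : 1 ≤ κ * F.card := Nat.mul_pos hκ hF
  have hκ' : κ ≤ (κ * F.card) ^ 4 ^ j :=
    (Nat.le_mul_of_pos_right κ hF).trans (Nat.le_self_pow (by positivity) _)
  calc (H (region H F j)).card ≤ κ * (region H F j).card ^ 2 :=
        hH _ (region_nonempty hne (Finset.card_pos.mp hF) j)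
    _ ≤ (κ * F.card) ^ 4 ^ j * ((κ * F.card) ^ 4 ^ j) ^ 2 := by
      gcongr
      exact card_region_le hκ hne hH hF j
    _ = (κ * F.card) ^ (3 * 4 ^ j) := by ring
    _ ≤ (κ * F.card) ^ (3 * 4 ^ m) := by gcongr; omega

/-- For every polynomially controlled choice of syndeticity constants `H`, labels can be placed
sparsely (the labelled positions are `Q`-independent) in finite regions `R j` so that, whenever
copies of the `j`-th labelling are centered at the points of an `H (R j)`-syndetic set `B j`, every
tuple of labels occurs simultaneously.  A random labelling works: each tuple of centers to be served
has `k` independent chances, while the number of these tuples grows polynomially in `k`. -/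
theorem exists_covering [Infinite G] [DecidableEq G] (m : ℕ) (Q : Finset G) (h1 : 1 ∈ Q)
    (Λ : Type*) [Finite Λ] (H : Finset G → Finset G) (κ : ℕ)
    (hne : ∀ R, (H R).Nonempty) (hH : ∀ R, R.Nonempty → (H R).card ≤ κ * R.card ^ 2) :
    ∃ (R : Fin m → Finset G) (c : Fin m → G → Option Λ),
      (∀ j g, c j g ≠ none → g ∈ R j) ∧ (∀ j, Independent Q {g | c j g ≠ none}) ∧
      ∀ B : Fin m → Set G, (∀ j g, ∃ u ∈ H (R j), u * g ∈ B j) → ∀ l : Fin m → Λ,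
        ∃ h, ∀ j, ∃ b ∈ B j, c j (h * b⁻¹) = some (l j) := by
  classical
  have := Fintype.ofFinite Λ
  -- replace `κ` by `κ + 1` to make it positive
  have hH' : ∀ R, R.Nonempty → (H R).card ≤ (κ + 1) * R.card ^ 2 := fun R hR =>
    (hH R hR).trans (by gcongr; omega)
  set r : ℕ := m * Q.card with hr
  set d : ℕ := 3 * 4 ^ m * m with hd
  set L : ℕ := (κ + 1) ^ d * Fintype.card (Fin m → Λ) with hL
  set δ : ℝ := ((Fintype.card (Option Λ) : ℝ) ^ r)⁻¹ with hδ
  have hA : (1 : ℝ) ≤ (Fintype.card (Option Λ) : ℝ) ^ r :=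
    one_le_pow₀ (by exact_mod_cast Fintype.card_pos)
  have hδ0 : 0 < δ := inv_pos.mpr (by linarith)
  have hδ1 : δ ≤ 1 := inv_le_one_of_one_le₀ hA
  obtain ⟨k, hk1, hk⟩ : ∃ k : ℕ, 1 ≤ k ∧ (L : ℝ) * ((k : ℝ) ^ d * (1 - δ) ^ k) < 1 := by
    have ht := (tendsto_pow_const_mul_const_pow_of_abs_lt_one d
      (r := 1 - δ) (by rw [abs_of_nonneg (by linarith)]; linarith)).const_mul (L : ℝ)
    rw [mul_zero] at ht
    obtain ⟨k, hk, hk'⟩ := ((ht.eventually_lt_const one_pos).and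
      (Filter.eventually_ge_atTop 1)).exists
    exact ⟨k, hk', hk⟩
  obtain ⟨F, hFk, hFsep⟩ := exists_separated Q k
  have hF1 : 1 ≤ F.card := hFk ▸ hk1
  let R : ℕ → Finset G := region H F
  let D : Finset G := Finset.univ.biUnion fun j : Fin m => R j
  have hRD : ∀ j : Fin m, R j ⊆ D := fun j =>
    Finset.subset_biUnion_of_mem (fun j : Fin m => R j) (Finset.mem_univ j)
  let W : Finset ((Fin m → G) × (Fin m → Λ)) :=
    (Fintype.piFinset fun j : Fin m => H (R j)) ×ˢ Finset.univ
  let pos : (Fin m → G) → G → Fin m → G := fun w f j => f * Fin.partialProd w j.castSucc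
  have hW : (W.card : ℝ) ≤ L * (k : ℝ) ^ d := by
    have : W.card ≤ L * k ^ d := by
      have hp : (Fintype.piFinset fun j : Fin m => H (R j)).card ≤ ((κ + 1) * k) ^ d := by
        rw [Fintype.card_piFinset]
        calc ∏ j : Fin m, (H (R j)).card ≤ ∏ _j : Fin m, ((κ + 1) * F.card) ^ (3 * 4 ^ m) :=
              Finset.prod_le_prod' fun j _ => card_step_le (by omega) hne hH' hF1 j.2.le
          _ = ((κ + 1) * k) ^ d := by
            rw [Finset.prod_const, Finset.card_univ, Fintype.card_fin, hFk, ← pow_mul]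
      calc W.card = (Fintype.piFinset fun j : Fin m => H (R j)).card *
            Fintype.card (Fin m → Λ) := by
            rw [Finset.card_product, Finset.card_univ]
        _ ≤ ((κ + 1) * k) ^ d * Fintype.card (Fin m → Λ) := by gcongr
        _ = L * k ^ d := by rw [hL, mul_pow]; ring
    exact_mod_cast this
  obtain ⟨θ, hθ⟩ := exists_display (V := Fin m × D) (A := Option Λ) W F
    (fun w f => Finset.univ.filter fun v => (v.2 : G) * (pos w.1 f v.1)⁻¹ ∈ Q)
    (fun w f v => if (v.2 : G) = pos w.1 f v.1 then some (w.2 v.1) else none) r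
    (by
      intro w _ f _
      calc _ ≤ ((Finset.univ : Finset (Fin m)) ×ˢ Q).card := by
            refine Finset.card_le_card_of_injOn
              (fun v => (v.1, (v.2 : G) * (pos w.1 f v.1)⁻¹)) ?_ ?_
            · intro v hv
              simpa using hv
            · rintro ⟨j, g⟩ _ ⟨j', g'⟩ _ h
              simp only [Prod.mk.injEq] at h
              obtain ⟨rfl, h⟩ := h
              rw [Prod.mk.injEq]
              exact ⟨rfl, Subtype.ext (mul_right_cancel h)⟩
        _ = r := by simp [hr])
    (by
      intro w _ f hf f' hf' hne
      rw [Finset.disjoint_left]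
      rintro ⟨j, g⟩ hg hg'
      simp only [Finset.mem_filter, Finset.mem_univ, true_and, pos] at hg hg'
      refine hne (hFsep f hf f' hf' _ hg _ hg' ?_)
      simp [mul_assoc])
    (by
      rw [hFk]
      calc (W.card : ℝ) * (1 - δ) ^ k ≤ L * (k : ℝ) ^ d * (1 - δ) ^ k := by
            gcongr
        _ < 1 := by rw [mul_assoc]; exact hk)
  let θ' : Fin m → G → Option Λ := fun j g => if h : g ∈ D then θ (j, ⟨g, h⟩) else none
  let c : Fin m → G → Option Λ := fun j g =>
    if g ∈ R j ∧ ∀ q ∈ Q, q ≠ 1 → θ' j (q * g) = none then θ' j g else none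
  refine ⟨fun j => R j, c, fun j g hg => ?_, fun j g hg q hq hqg => ?_, fun B hB l => ?_⟩
  · by_contra h
    exact hg (if_neg fun h' => h h'.1)
  · by_contra hq1
    simp only [Set.mem_ofPred_eq, c, smul_eq_mul] at hg hqg
    split_ifs at hg with hc
    · split_ifs at hqg
      · exact hqg (hc.2 q hq hq1)
      · exact hqg rfl
    · exact hg rfl
  · obtain ⟨w, b, hwb⟩ := exists_walk (fun j => H (R j)) B hB
    obtain ⟨f, hf, hθf⟩ := hθ (w, l) (Finset.mem_product.mpr
      ⟨Fintype.mem_piFinset.mpr fun j => (hwb j).1, Finset.mem_univ _⟩)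
    refine ⟨f * b 0, fun j => ⟨b j.castSucc, (hwb j).2.1, ?_⟩⟩
    have hpos : f * b 0 * (b j.castSucc)⁻¹ = pos w f j := by
      rw [← partialProd_mul_eq (fun j => (hwb j).2.2) j.castSucc]
      simp [pos, mul_assoc]
    have hposR : pos w f j ∈ R j := by
      simpa using partialProd_mem_region (fun j => (hwb j).1) hf j.castSucc
    have hnone : ∀ q ∈ Q, q ≠ 1 → θ' j (q * pos w f j) = none := by
      intro q hq hq1
      simp only [θ']
      split_ifs with hD
      · rw [hθf (j, ⟨q * pos w f j, hD⟩) (by simpa using hq)]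
        simp [hq1]
      · rfl
    rw [hpos]
    simp only [c]
    rw [if_pos ⟨hposR, hnone⟩]
    simp only [θ', hRD j hposR, dif_pos]
    rw [hθf (j, ⟨pos w f j, hRD j hposR⟩) (by simpa using h1)]
    simp

end Covering

/-! ### Stages of the construction -/

/-- A stage of the construction: a set of configurations for every node of level `n` of the binary
tree, together with a common gap for their irreducibility. -/
structure Stage (G : Type u) (n : ℕ) where
  configs : (Fin n → Bool) → Set (Config G)
  gap : Finset G

/-- The invariants of the construction. For the irreducibility, `G` carries the `σ`-algebra of all
its subsets. -/
structure Stage.Good {G : Type u} [Group G] {n : ℕ} (st : Stage G n) : Prop where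
  symm : IsSymmWithOne st.gap
  depends : ∀ t, DependsBelow n (st.configs t)
  invariant : ∀ t g, ∀ z ∈ st.configs t, shift g z ∈ st.configs t
  closed : ∀ t, IsClosed (st.configs t)
  glues : ∀ t, @Glues G G _ ⊤ _ st.gap n (st.configs t)

/-- `st'` refines `st` by the blocks `b`, which are sparse (the independence of each block admits
`N` times as many disjoint translates as the block needs room) and make the product over all nodes
minimal, as far as the finite window `W` and the layers below `n` can see. -/
structure Stage.Refines {G : Type u} [Group G] [DecidableEq G] {n : ℕ} (W : Finset G) (N : ℕ)
    (st : Stage G n) (st' : Stage G (n + 1)) (b : (Fin (n + 1) → Bool) → Block G) : Prop where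
  configs_eq : ∀ t, st'.configs t = blockRefine n (st.configs (Fin.init t)) (b t)
  compatible : ∀ t, (b t).Compatible st.gap
  pattern_mem : ∀ t, (b t).pattern ∈ st.configs (Fin.init t)
  sparse : ∀ t, ∃ U : Finset G, U⁻¹ * U ⊆ (b t).indep ∧
    N * (st.gap.card * (b t).window.card) ≤ U.card
  gap_spec : ∃ A : Finset G, IsSymmWithOne A ∧ st.gap ⊆ A ∧ (∀ t, (b t).window ⊆ A) ∧
    (∀ t, (b t).indep ⊆ A) ∧ ∀ a ∈ A, ∀ u ∈ A * A * A, ∀ v ∈ A * A * A, v⁻¹ * a * u ∈ st'.gap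
  minimal : ∀ z : (Fin (n + 1) → Bool) → Config G, (∀ t, z t ∈ st'.configs t) →
    ∀ y : (Fin (n + 1) → Bool) → Config G, (∀ t, y t ∈ st.configs (Fin.init t)) →
      ∃ h, ∀ t, ∀ g ∈ W, AgreeBelow n (z t (g * h)) (y t g)

section Stage

variable {G : Type u} [Group G]

theorem freeBorelAction_self [Countable G] : @FreeBorelAction G G _ ⊤ _ := by
  let _ : MeasurableSpace G := ⊤
  refine ⟨fun g => measurable_from_top, fun g x h => by simpa using h, ?_⟩
  obtain ⟨e, he⟩ := exists_injective_nat G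
  refine ⟨fun g i => decide (i = e g), measurable_from_top, fun g g' h => ?_⟩
  have := congrFun h (e g)
  simp only [decide_true] at this
  exact he (of_decide_eq_true this.symm)

theorem isClosed_setOf_forall {X : Type*} {ι : Sort*} [TopologicalSpace X] {p : ι → X → Prop}
    (h : ∀ i, IsClosed {x | p i x}) : IsClosed {x | ∀ i, p i x} := by
  convert isClosed_iInter h using 1
  ext x
  simp

theorem isClosed_setOf_exists_mem {X ι : Type*} [TopologicalSpace X] (s : Finset ι)
    {p : ι → X → Prop} (h : ∀ i ∈ s, IsClosed {x | p i x}) : IsClosed {x | ∃ i ∈ s, p i x} := by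
  convert s.finite_toSet.isClosed_biUnion h using 1
  ext x
  simp

theorem isClosed_blockRefine {n : ℕ} {Z : Set (Config G)} (hZ : IsClosed Z) (b : Block G) :
    IsClosed (blockRefine n Z b) := by
  have hclopen : ∀ (g : G) (i : ℕ) (p : Bool × Bool → Prop), IsClopen {z : Config G | p (z g i)} :=
    fun g i p => (isClopen_discrete {a | p a}).preimage
      ((continuous_apply i).comp (continuous_apply g))
  have hmark : ∀ g : G, IsClopen {z : Config G | (z g n).2 = true} := fun g =>
    hclopen g n fun a => a.2 = true
  have h1 : IsClosed {z : Config G | Independent b.indep {g : G | (z g n).2 = true}} :=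
    isClosed_setOf_forall fun g => isClosed_imp (hmark g).2 <| isClosed_setOf_forall fun u =>
      isClosed_imp isOpen_const <| isClosed_imp (hmark (u • g)).2 isClosed_const
  have h2 : IsClosed {z : Config G | ∀ g, ∃ u ∈ b.indep, (z (u * g) n).2 = true} :=
    isClosed_setOf_forall fun g => isClosed_setOf_exists_mem _ fun u _ => (hmark (u * g)).1
  have h3 : IsClosed {z : Config G | ∀ g, (z g n).2 = true → ∀ e ∈ b.window,
      AgreeBelow n (z (e * g)) (b.pattern e)} :=
    isClosed_setOf_forall fun g => isClosed_imp (hmark g).2 <| isClosed_setOf_forall fun e =>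
      isClosed_imp isOpen_const <| isClosed_setOf_forall fun i => isClosed_imp isOpen_const
        (hclopen (e * g) i fun a => a = b.pattern e i).1
  exact hZ.inter (h1.inter (h2.inter h3))

theorem Stage.Good.nonempty [Countable G] {n : ℕ} {st : Stage G n} (h : st.Good)
    (t : Fin n → Bool) : (st.configs t).Nonempty := by
  let _ : MeasurableSpace G := ⊤
  exact (h.glues t).nonempty

/-- Sparsely placed patterns from `Z` extend to a configuration in `Z`: if `c` labels independent
positions, then the windows around these positions can display the patterns `p` of their labels. -/
theorem Glues.exists_config [Countable G] [DecidableEq G] {Q : Finset G} {n : ℕ}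
    {Z : Set (Config G)} (hZ : @Glues G G _ ⊤ _ Q n Z) (hinv : ∀ g, ∀ z ∈ Z, shift g z ∈ Z)
    (hQ : 1 ∈ Q) {Λ : Type*} (p : Λ → Config G) (hp : ∀ l, p l ∈ Z) (W : Finset G)
    {V : Finset G} (hV : ∀ e ∈ W, ∀ e' ∈ W, ∀ q ∈ Q, e'⁻¹ * q * e ∈ V)
    {c : G → Option Λ} (hc : Independent V {g | c g ≠ none}) :
    ∃ P ∈ Z, ∀ g l, c g = some l → ∀ e ∈ W, AgreeBelow n (P (e * g)) (p l e) := by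
  classical
  let _ : MeasurableSpace G := ⊤
  obtain ⟨z₀, hz₀⟩ := hZ.nonempty
  let f : G → Config G := fun g => (c g).elim z₀ p
  have hfZ : ∀ g, f g ∈ Z := by
    intro g
    rcases h : c g with _ | l
    · simpa [f, h] using hz₀
    · simpa [f, h] using hp l
  have hS : MeasurableSet {g : G | c g ≠ none} := trivial
  obtain ⟨F, hF, hFs⟩ := (freeBorelAction_self (G := G)).exists_spread hS
    (f := f) measurable_from_top W fun s hs g hg h hh hgh => by
      have := hc s hs _ (by simpa using hV g hg h hh 1 hQ) hgh
      rw [this, one_smul, shift_one]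
  obtain ⟨ζ, -, hζZ, hζ⟩ := hZ ((W : Set G) • {g : G | c g ≠ none}) F trivial hF
    (by
      rintro _ ⟨e, he, s, hs, rfl⟩
      change F (e • s) ∈ Z
      rw [hFs s hs e he]
      exact hinv _ _ (hfZ s))
    (by
      rintro _ ⟨e, he, s, hs, rfl⟩ q hq ⟨e', he', s', hs', h⟩
      change e' • s' = q • e • s at h
      have h' : s' = (e'⁻¹ * q * e) • s := by
        rw [mul_smul, mul_smul, ← h, inv_smul_smul]
      have h1 := hc s hs _ (hV e he e' he' q hq) (h' ▸ hs')
      have h2 : e' = q * e := by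
        rw [mul_assoc, inv_mul_eq_one] at h1
        exact h1
      rw [h1, one_smul] at h'
      change F (q • e • s) = shift q (F (e • s))
      rw [← h, hFs s' hs' e' he', hFs s hs e he, shift_shift, h2, h'])
  refine ⟨orbitConfig ζ (1 : G), hζZ 1, fun g l hgl e he => ?_⟩
  have hg : g ∈ {g : G | c g ≠ none} := by simp [hgl]
  have := hζ (e • g) ⟨e, he, g, hg, rfl⟩
  rw [hFs g hg e he, shift_apply_one] at this
  simpa [f, hgl, orbitConfig] using this

theorem IsSymmWithOne.conj [DecidableEq G] {Q : Finset G} (hQ : IsSymmWithOne Q) {E : Finset G}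
    (hE : E.Nonempty) : IsSymmWithOne (E⁻¹ * Q * E) := by
  obtain ⟨e, he⟩ := hE
  refine ⟨Finset.mem_mul.mpr ⟨e⁻¹, Finset.mem_mul.mpr ⟨e⁻¹, Finset.inv_mem_inv he, 1, hQ.1,
    by simp⟩, e, he, by simp⟩, fun g hg => ?_⟩
  obtain ⟨x, hx, y, hy, rfl⟩ := Finset.mem_mul.mp hg
  obtain ⟨z, hz, q, hq, rfl⟩ := Finset.mem_mul.mp hx
  rw [show (z * q * y)⁻¹ = y⁻¹ * q⁻¹ * z⁻¹ by group]
  exact Finset.mul_mem_mul (Finset.mul_mem_mul (Finset.inv_mem_inv hy) (hQ.2 q hq))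
    (Finset.mem_inv'.mp hz)

theorem IsSymmWithOne.union [DecidableEq G] {Q Q' : Finset G} (hQ : IsSymmWithOne Q)
    (hQ' : ∀ g ∈ Q', g⁻¹ ∈ Q') : IsSymmWithOne (Q ∪ Q') := by
  refine ⟨Finset.mem_union_left _ hQ.1, fun g hg => ?_⟩
  rcases Finset.mem_union.mp hg with h | h
  · exact Finset.mem_union_left _ (hQ.2 g h)
  · exact Finset.mem_union_right _ (hQ' g h)

/-- Every stage can be refined. -/
theorem Stage.Good.exists_refines [Countable G] [Infinite G] [DecidableEq G] {n : ℕ}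
    {st : Stage G n} (hst : st.Good) {W : Finset G} (hW : W.Nonempty) (N : ℕ) :
    ∃ (st' : Stage G (n + 1)) (b : (Fin (n + 1) → Bool) → Block G),
      st'.Good ∧ st.Refines W N st' b := by
  classical
  obtain ⟨Z, Q⟩ := st
  obtain ⟨hQ, hdep, hinv, hclosed, hglues⟩ := hst
  have hne := fun t => Stage.Good.nonempty (st := ⟨Z, Q⟩) ⟨hQ, hdep, hinv, hclosed, hglues⟩ t
  simp only at hQ hdep hinv hclosed hglues hne
  let T := Fin (n + 1) → Bool
  let e : T ≃ Fin (Fintype.card T) := Fintype.equivFin T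
  -- the labels are the patterns that are visible through `W`
  let Λ := W → Fin n → Bool × Bool
  let pat : Config G → Λ := fun y g i => y g i
  have hrep : ∀ (t : T) (l : Λ), ∃ y ∈ Z (Fin.init t), ∀ y' ∈ Z (Fin.init t), pat y' = l →
      ∀ g ∈ W, AgreeBelow n (y g) (y' g) := by
    intro t l
    by_cases h : ∃ y ∈ Z (Fin.init t), pat y = l
    · obtain ⟨y, hy, rfl⟩ := h
      refine ⟨y, hy, fun y' _ h' g hg i hi => ?_⟩
      exact (congrFun (congrFun h' ⟨g, hg⟩) ⟨i, hi⟩).symm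
    · obtain ⟨y, hy⟩ := hne (Fin.init t)
      exact ⟨y, hy, fun y' hy' h' => absurd ⟨y', hy', h'⟩ h⟩
  choose rep hrepZ hrep using hrep
  set K : ℕ := N * (Q.card * W.card) + 1 with hK
  have hU' : ∀ R : Finset G, ∃ U : Finset G, U.card = N * (Q.card * (W.card * R.card)) + 1 :=
    fun R => by
      obtain ⟨F, hF, -⟩ := exists_separated (G := G) ∅ (N * (Q.card * (W.card * R.card)) + 1)
      exact ⟨F, hF⟩
  choose U' hU' using hU'
  have hU'ne : ∀ R, (U' R).Nonempty := fun R => Finset.card_pos.mp (by rw [hU']; omega)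
  let H : Finset G → Finset G := fun R => (U' R)⁻¹ * {1} * U' R ∪ (W * R)⁻¹ * Q * (W * R)
  have hone : IsSymmWithOne ({1} : Finset G) := ⟨by simp, by simp⟩
  have hHsymm : ∀ R, IsSymmWithOne (H R) := fun R => by
    refine (hone.conj (hU'ne R)).union ?_
    rcases (W * R).eq_empty_or_nonempty with h | h
    · simp [h]
    · exact (hQ.conj h).2
  have hHcard : ∀ R : Finset G, R.Nonempty →
      (H R).card ≤ (K ^ 2 + Q.card * W.card ^ 2) * R.card ^ 2 := by
    intro R hR
    have hR1 : 1 ≤ R.card := Finset.card_pos.mpr hR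
    have h1 : (U' R).card ≤ K * R.card := by
      rw [hU', hK]
      nlinarith
    have h2 : ((U' R)⁻¹ * {1} * U' R).card ≤ (K * R.card) * (K * R.card) := by
      refine Finset.card_mul_le.trans (Nat.mul_le_mul (Finset.card_mul_le.trans ?_) h1)
      simpa using h1
    have hWR : (W * R).card ≤ W.card * R.card := Finset.card_mul_le
    have h3 : ((W * R)⁻¹ * Q * (W * R)).card ≤
        ((W.card * R.card) * Q.card) * (W.card * R.card) := by
      refine Finset.card_mul_le.trans (Nat.mul_le_mul (Finset.card_mul_le.trans ?_) hWR)
      rw [Finset.card_inv]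
      exact Nat.mul_le_mul_right _ hWR
    calc (H R).card ≤ _ := Finset.card_union_le _ _
      _ ≤ _ := Nat.add_le_add h2 h3
      _ = _ := by ring
  let V : Finset G := W⁻¹ * Q * W
  have hV : ∀ e ∈ W, ∀ e' ∈ W, ∀ q ∈ Q, e'⁻¹ * q * e ∈ V := fun e he e' he' q hq =>
    Finset.mul_mem_mul (Finset.mul_mem_mul (Finset.inv_mem_inv he') hq) he
  obtain ⟨R, c, hcR, hcV, hcov⟩ := exists_covering (Fintype.card T) V (hQ.conj hW).1 Λ H _
    (fun R => ⟨1, (hHsymm R).1⟩) hHcard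
  have hP : ∀ t : T, ∃ P ∈ Z (Fin.init t), ∀ g l, c (e t) g = some l → ∀ w ∈ W,
      AgreeBelow n (P (w * g)) (rep t l w) := fun t =>
    (hglues (Fin.init t)).exists_config (hinv _) hQ.1 (rep t) (hrepZ t) W hV (hcV (e t))
  choose P hPZ hP using hP
  let b : T → Block G := fun t => ⟨W * R (e t), H (R (e t)), P t⟩
  have hcomp : ∀ t, (b t).Compatible Q := fun t => ⟨hHsymm _, fun x hx x' hx' q hq =>
    Finset.mem_union_right _
      (Finset.mul_mem_mul (Finset.mul_mem_mul (Finset.inv_mem_inv hx') hq) hx)⟩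
  let A₀ : Finset G := Finset.univ.biUnion fun t : T => (b t).window ∪ (b t).indep
  let A : Finset G := Q ∪ (A₀ ∪ A₀⁻¹)
  have hA : IsSymmWithOne A := hQ.union fun g hg => by
    rcases Finset.mem_union.mp hg with h | h
    · exact Finset.mem_union_right _ (Finset.inv_mem_inv h)
    · exact Finset.mem_union_left _ (Finset.mem_inv'.mp h)
  have hA₀ : ∀ t, (b t).window ∪ (b t).indep ⊆ A := fun t =>
    (Finset.subset_biUnion_of_mem (fun t : T => (b t).window ∪ (b t).indep)
      (Finset.mem_univ t)).trans (Finset.subset_union_left.trans Finset.subset_union_right)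
  have hEA : ∀ t, (b t).window ⊆ A := fun t => Finset.subset_union_left.trans (hA₀ t)
  have hUA : ∀ t, (b t).indep ⊆ A := fun t => Finset.subset_union_right.trans (hA₀ t)
  have hQA : Q ⊆ A := Finset.subset_union_left
  let Q' : Finset G := (A * A * A)⁻¹ * A * (A * A * A)
  have hQ' : ∀ a ∈ A, ∀ u ∈ A * A * A, ∀ v ∈ A * A * A, v⁻¹ * a * u ∈ Q' := fun a ha u hu v hv =>
    Finset.mul_mem_mul (Finset.mul_mem_mul (Finset.inv_mem_inv hv) ha) hu
  have hAne : A.Nonempty := ⟨1, hA.1⟩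
  refine ⟨⟨fun t => blockRefine n (Z (Fin.init t)) (b t), Q'⟩, b,
    ⟨hA.conj ((hAne.mul hAne).mul hAne),
    fun t => dependsBelow_blockRefine (hdep _) _,
    fun t g z hz => shift_mem_blockRefine (hinv _) g hz,
    fun t => isClosed_blockRefine (hclosed _) _, fun t => ?_⟩,
    ⟨fun t => rfl, hcomp, hPZ, fun t => ⟨U' (R (e t)), ?_, ?_⟩,
      ⟨A, hA, hQA, hEA, hUA, hQ'⟩, fun z hz y hy => ?_⟩⟩
  · exact @glues_blockRefine G G _ _ ⊤ _ freeBorelAction_self _ _ _ (hglues (Fin.init t))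
      (hdep _) (hinv _) hQ _ (hcomp t) (hPZ t) _ _ hA hQA (hEA t) (hUA t) hQ'
  · have : (U' (R (e t)))⁻¹ * U' (R (e t)) ⊆ (U' (R (e t)))⁻¹ * {1} * U' (R (e t)) := by
      rw [Finset.singleton_one, mul_one]
    exact this.trans Finset.subset_union_left
  · rw [hU']
    have : (b t).window.card ≤ W.card * (R (e t)).card := Finset.card_mul_le
    calc N * (Q.card * (b t).window.card) ≤ N * (Q.card * (W.card * (R (e t)).card)) := by gcongr
      _ ≤ _ := Nat.le_succ _
  · obtain ⟨h, hh⟩ := hcov (fun j => {g | (z (e.symm j) g n).2 = true})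
      (fun j g => by simpa [b] using (hz (e.symm j)).2.2.1 g) fun j => pat (y (e.symm j))
    refine ⟨h, fun t g hg => ?_⟩
    obtain ⟨x, hx, hcx⟩ := hh (e t)
    simp only [Set.mem_ofPred_eq, Equiv.symm_apply_apply] at hx hcx
    have hmem : h * x⁻¹ ∈ R (e t) := hcR _ _ (by rw [hcx]; simp)
    have h1 := (hz t).2.2.2 x hx (g * (h * x⁻¹)) (Finset.mul_mem_mul hg hmem)
    rw [show g * (h * x⁻¹) * x = g * h by group] at h1
    exact h1.trans ((hP t _ _ hcx g hg).trans (hrep t _ (y t) (hy t) rfl g hg))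

end Stage

/-! ### The tower of refinements and its limit flows -/

/-- An infinite sequence of successive refinements; the set of configurations at a node of level `n`
is minimal as far as the `n`-th window can see, and the windows exhaust `G`. -/
structure Tower (G : Type u) [Group G] [DecidableEq G] where
  window : ℕ → Finset G
  window_mono : Monotone window
  exists_mem_window : ∀ g, ∃ n, g ∈ window n
  stage : ∀ n, Stage G n
  block : ∀ n, (Fin (n + 1) → Bool) → Block G
  stage_zero : ∀ t, (stage 0).configs t = Set.univ
  good : ∀ n, (stage n).Good
  refines : ∀ n, (stage n).Refines (window n) (2 ^ n) (stage (n + 1)) (block n)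

section Tower

theorem exists_agree_subset_of_isOpen {G : Type u} {O : Set (Config G)} (hO : IsOpen O)
    {x : Config G} (hx : x ∈ O) : ∃ (F : Finset G) (m : ℕ), ∀ z : Config G,
      (∀ g ∈ F, AgreeBelow m (z g) (x g)) → z ∈ O := by
  classical
  obtain ⟨F, u, hu, hsub⟩ := isOpen_pi_iff.mp hO x hx
  have h : ∀ g, ∃ m : ℕ, g ∈ F → ∀ a, AgreeBelow m a (x g) → a ∈ u g := by
    intro g
    by_cases hg : g ∈ F
    · obtain ⟨L, v, hv, hLsub⟩ := isOpen_pi_iff.mp (hu g hg).1 (x g) (hu g hg).2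
      refine ⟨L.sup id + 1, fun _ a ha => hLsub fun l hl => ?_⟩
      have := Finset.le_sup (f := id) hl
      rw [ha l (Nat.lt_succ_of_le this)]
      exact (hv l hl).2
    · exact ⟨0, fun h => absurd h hg⟩
  choose m hm using h
  exact ⟨F, F.sup m, fun z hz => hsub fun g hg => hm g hg _ ((hz g hg).mono (Finset.le_sup hg))⟩

variable {G : Type u} [Group G]

theorem exists_tower (G : Type u) [Group G] [DecidableEq G] [Countable G] [Infinite G] :
    Nonempty (Tower G) := by
  obtain ⟨f, hf⟩ := exists_surjective_nat G
  let W : ℕ → Finset G := fun n => (Finset.range (n + 1)).image f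
  have hW : ∀ n, (W n).Nonempty := fun n => ⟨f 0, Finset.mem_image_of_mem f (by simp)⟩
  have hgood : (⟨fun _ => Set.univ, {1}⟩ : Stage G 0).Good :=
    ⟨⟨by simp, by simp⟩, fun _ _ _ _ _ => trivial, fun _ _ _ _ => trivial,
      fun _ => isClosed_univ, fun _ => @glues_univ G G _ _ ⊤⟩
  choose next b hnext href using fun (n : ℕ) (st : {st : Stage G n // st.Good}) =>
    st.2.exists_refines (hW n) (2 ^ n)
  let T : ∀ n, {st : Stage G n // st.Good} := fun n =>
    Nat.rec ⟨_, hgood⟩ (fun n st => ⟨next n st, hnext n st⟩) n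
  exact ⟨{
    window := W
    window_mono := fun m n hmn => Finset.image_subset_image (Finset.range_mono (by omega))
    exists_mem_window := fun g => by
      obtain ⟨n, rfl⟩ := hf g
      exact ⟨n, Finset.mem_image_of_mem f (by simp)⟩
    stage := fun n => (T n).1
    block := fun n => b n (T n)
    stage_zero := fun _ => rfl
    good := fun n => (T n).2
    refines := fun n => href n (T n) }⟩

theorem continuous_shift (g : G) : Continuous (shift g : Config G → Config G) :=
  continuous_pi fun h => continuous_apply (h * g)

variable [DecidableEq G]

/-- The configurations at level `n` of the branch `i`. -/
def Tower.level (T : Tower G) (i : ℕ → Bool) (n : ℕ) : Set (Config G) :=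
  (T.stage n).configs fun k => i k

/-- The limit along the branch `i`. -/
def Tower.flowSet (T : Tower G) (i : ℕ → Bool) : Set (Config G) := ⋂ n, T.level i n

/-- The subshift obtained along the branch `i`, as a type. -/
abbrev Tower.Flow (T : Tower G) (i : ℕ → Bool) : Type u := T.flowSet i

theorem Tower.level_succ (T : Tower G) (i : ℕ → Bool) (n : ℕ) :
    T.level i (n + 1) = blockRefine n (T.level i n) (T.block n fun k => i k) :=
  (T.refines n).configs_eq _

theorem Tower.level_antitone (T : Tower G) (i : ℕ → Bool) : Antitone (T.level i) :=
  antitone_nat_of_succ_le fun n => by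
    rw [T.level_succ]
    exact fun z hz => hz.1

theorem Tower.isClosed_flowSet (T : Tower G) (i : ℕ → Bool) : IsClosed (T.flowSet i) :=
  isClosed_iInter fun n => (T.good n).closed _

theorem Tower.flowSet_nonempty [Countable G] (T : Tower G) (i : ℕ → Bool) :
    (T.flowSet i).Nonempty :=
  IsCompact.nonempty_iInter_of_sequence_nonempty_isCompact_isClosed _
    (fun n => T.level_antitone i n.le_succ) (fun n => (T.good n).nonempty _)
    ((T.good 0).closed _).isCompact fun n => (T.good n).closed _

theorem Tower.shift_mem_flowSet (T : Tower G) {i : ℕ → Bool} (g : G) {z : Config G}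
    (hz : z ∈ T.flowSet i) : shift g z ∈ T.flowSet i :=
  Set.mem_iInter.mpr fun n => (T.good n).invariant _ g z (Set.mem_iInter.mp hz n)

instance (T : Tower G) (i : ℕ → Bool) : MulAction G (T.Flow i) where
  smul g z := ⟨shift g z.1, T.shift_mem_flowSet g z.2⟩
  one_smul z := Subtype.ext (shift_one z.1)
  mul_smul g h z := Subtype.ext (shift_shift g h z.1).symm

theorem Tower.coe_smul (T : Tower G) {i : ℕ → Bool} (g : G) (z : T.Flow i) :
    ((g • z : T.Flow i) : Config G) = shift g z.1 := rfl

theorem Tower.isFlow [Countable G] (T : Tower G) (i : ℕ → Bool) : IsFlow G (T.Flow i) where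
  nonempty := (T.flowSet_nonempty i).to_subtype
  compact := isCompact_iff_compactSpace.mp (T.isClosed_flowSet i).isCompact
  hausdorff := inferInstance
  continuous_smul g := ((continuous_shift g).comp continuous_subtype_val).subtype_mk _

theorem exists_level_injOn (J : Finset (ℕ → Bool)) :
    ∃ n, ∀ i ∈ J, ∀ j ∈ J, (∀ k < n, i k = j k) → i = j := by
  have h : ∀ p : (ℕ → Bool) × (ℕ → Bool), ∃ k, p.1 ≠ p.2 → p.1 k ≠ p.2 k := fun p => by
    by_cases hp : p.1 = p.2
    · exact ⟨0, fun h => absurd hp h⟩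
    · obtain ⟨k, hk⟩ := Function.ne_iff.mp hp
      exact ⟨k, fun _ => hk⟩
  choose d hd using h
  refine ⟨(J ×ˢ J).sup d + 1, fun i hi j hj hij => ?_⟩
  by_contra hne
  refine hd (i, j) hne (hij _ (Nat.lt_succ_of_le ?_))
  exact Finset.le_sup (f := d) (Finset.mem_product.mpr ⟨hi, hj⟩)

theorem Tower.exists_window (T : Tower G) (F : Finset G) : ∃ n, F ⊆ T.window n := by
  choose d hd using T.exists_mem_window
  exact ⟨F.sup d, fun g hg => T.window_mono (Finset.le_sup hg) (hd g)⟩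

/-- Finitely many branches are simultaneously minimal: a single translation moves given
configurations close to given targets. -/
theorem Tower.exists_agree (T : Tower G) (J : Finset (ℕ → Bool)) {z y : (ℕ → Bool) → Config G}
    (hz : ∀ i, z i ∈ T.flowSet i) (hy : ∀ i, y i ∈ T.flowSet i) (F : Finset G) (m : ℕ) :
    ∃ h, ∀ i ∈ J, ∀ g ∈ F, AgreeBelow m (z i (g * h)) (y i g) := by
  classical
  obtain ⟨n₁, hn₁⟩ := exists_level_injOn J
  obtain ⟨n₂, hn₂⟩ := T.exists_window F
  set n := max m (max n₁ n₂) with hn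
  -- pick a branch through every node of level `n + 1`, if possible one of the given branches
  have hsel : ∀ t : Fin (n + 1) → Bool, ∃ i : ℕ → Bool, (∀ k : Fin (n + 1), i k = t k) ∧
      ∀ j ∈ J, (∀ k : Fin (n + 1), j k = t k) → i = j := by
    intro t
    by_cases h : ∃ i ∈ J, ∀ k : Fin (n + 1), i k = t k
    · obtain ⟨i, hi, hit⟩ := h
      refine ⟨i, hit, fun j hj hjt => hn₁ i hi j hj fun k hk => ?_⟩
      have hk' : k < n + 1 := by omega
      exact (hit ⟨k, hk'⟩).trans (hjt ⟨k, hk'⟩).symm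
    · exact ⟨fun k => if hk : k < n + 1 then t ⟨k, hk⟩ else false, fun k => dif_pos k.2,
        fun j hj hjt => absurd ⟨j, hj, hjt⟩ h⟩
  choose sel hselt hselJ using hsel
  have hsel' : ∀ t, (fun k : Fin (n + 1) => sel t k) = t := fun t => funext (hselt t)
  obtain ⟨h, hh⟩ := (T.refines n).minimal (fun t => z (sel t))
    (fun t => by
      have := Set.mem_iInter.mp (hz (sel t)) (n + 1)
      rwa [Tower.level, hsel' t] at this)
    (fun t => y (sel t))
    (fun t => by
      have := Set.mem_iInter.mp (hy (sel t)) n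
      have h' : (fun k : Fin n => sel t k) = Fin.init t := funext fun k => hselt t k.castSucc
      rwa [Tower.level, h'] at this)
  refine ⟨h, fun i hi g hg => ?_⟩
  have hi' : sel (fun k => i k) = i := hselJ _ i hi fun _ => rfl
  have := hh (fun k => i k) g (T.window_mono (by omega) (hn₂ hg))
  rw [hi'] at this
  exact this.mono (by omega)

/-- The product of the subshifts along different branches is minimal. -/
theorem Tower.mutuallyDisjoint [Countable G] (T : Tower G) {I : Type v} (e : I ≃ (ℕ → Bool)) :
    MutuallyDisjoint G fun i => T.Flow (e i) := by
  classical
  have hflow := fun i => T.isFlow (e i)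
  have := fun i => (hflow i).nonempty
  have := fun i => (hflow i).compact
  refine ⟨⟨inferInstance, inferInstance, inferInstance, fun g => continuous_pi fun i =>
    ((hflow i).continuous_smul g).comp (continuous_apply i)⟩, fun z y => ?_⟩
  rw [mem_closure_iff]
  intro O hO hyO
  obtain ⟨J, u, hu, hsub⟩ := isOpen_pi_iff.mp hO y hyO
  have h : ∀ i, ∃ (F : Finset G) (m : ℕ), i ∈ J → ∀ x : T.Flow (e i),
      (∀ g ∈ F, AgreeBelow m (x.1 g) ((y i).1 g)) → x ∈ u i := by
    intro i
    by_cases hi : i ∈ J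
    · obtain ⟨O', hO', hOu⟩ := isOpen_induced_iff.mp (hu i hi).1
      have hyO' : (y i).1 ∈ O' := by
        have := (hu i hi).2
        rwa [← hOu] at this
      obtain ⟨F, m, hF⟩ := exists_agree_subset_of_isOpen hO' hyO'
      refine ⟨F, m, fun _ x hx => ?_⟩
      rw [← hOu]
      exact hF x.1 hx
    · exact ⟨∅, 0, fun h => absurd h hi⟩
  choose F m hFm using h
  obtain ⟨h, hh⟩ := T.exists_agree (J.map e.toEmbedding)
    (z := fun j => (z (e.symm j)).1) (y := fun j => (y (e.symm j)).1)
    (fun j => by simpa using (z (e.symm j)).2) (fun j => by simpa using (y (e.symm j)).2)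
    (J.biUnion F) (J.sup m)
  refine ⟨h • z, hsub fun i hi => hFm i hi _ fun g hg => ?_, h, rfl⟩
  have := hh (e i) (by simpa using hi) g (Finset.mem_biUnion.mpr ⟨i, hi, hg⟩)
  have hz : (z (e.symm (e i))).1 = (z i).1 := by rw [e.symm_apply_apply]
  have hy : (y (e.symm (e i))).1 = (y i).1 := by rw [e.symm_apply_apply]
  rw [hz, hy] at this
  exact this.mono (Finset.le_sup hi)

/-- A factor of a minimal product is minimal. -/
theorem Tower.isMinimalFlow [Countable G] (T : Tower G) (i : ℕ → Bool) :
    IsMinimalFlow G (T.Flow i) := by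
  classical
  refine ⟨T.isFlow i, fun z => ?_⟩
  have hne := fun j => (T.isFlow j).nonempty
  let z' : ∀ j, T.Flow j := Function.update (fun j => Classical.choice (hne j)) i z
  have hz' : z' i = z := Function.update_self ..
  have hdense := (T.mutuallyDisjoint (Equiv.refl _)).dense_orbit z'
  have hsurj : Function.Surjective (Function.eval i : (∀ j, T.Flow j) → T.Flow i) :=
    Function.surjective_eval i
  refine (hsurj.denseRange.dense_image (continuous_apply i) hdense).mono ?_
  rintro _ ⟨_, ⟨g, rfl⟩, rfl⟩
  exact ⟨g, by rw [← hz']; rfl⟩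

end Tower

/-! ### Embedding free actions into the limit flows -/

section Universal

open Filter Topology

variable {G : Type u} [Group G] {X : Type w} [MeasurableSpace X] [MulAction G X]

theorem card_mul_measure_le_one {μ : Measure X} [IsProbabilityMeasure μ]
    (hμ : ∀ g : G, MeasurePreserving (fun x : X => g • x) μ μ) [DecidableEq G] {V U : Finset G}
    (hU : U⁻¹ * U ⊆ V) {B : Set X} (hB : MeasurableSet B) (hBV : Independent V B) :
    (U.card : ENNReal) * μ B ≤ 1 := by
  have hpre : ∀ u : G, μ ((fun x : X => u⁻¹ • x) ⁻¹' B) = μ B := fun u =>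
    (hμ u⁻¹).measure_preimage hB.nullMeasurableSet
  have hdisj : (U : Set G).PairwiseDisjoint fun u => (fun x : X => u⁻¹ • x) ⁻¹' B := by
    intro u hu v hv huv
    rw [Function.onFun, Set.disjoint_left]
    intro x hxu hxv
    have h : (v⁻¹ * u) • u⁻¹ • x = v⁻¹ • x := by
      rw [smul_smul]
      simp
    have h1 := hBV _ hxu (v⁻¹ * u) (hU (Finset.mul_mem_mul (Finset.inv_mem_inv hv) hu))
      (by rw [h]; exact hxv)
    exact huv (inv_mul_eq_one.mp h1).symm
  calc (U.card : ENNReal) * μ B = ∑ u ∈ U, μ ((fun x : X => u⁻¹ • x) ⁻¹' B) := by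
        simp [hpre]
    _ = μ (⋃ u ∈ U, (fun x : X => u⁻¹ • x) ⁻¹' B) :=
        (measure_biUnion_finset hdisj fun u _ => (hμ u⁻¹).measurable hB).symm
    _ ≤ 1 := prob_le_one

theorem measure_smul_le {μ : Measure X}
    (hμ : ∀ g : G, MeasurePreserving (fun x : X => g • x) μ μ) (V : Finset G)
    {B : Set X} (hB : MeasurableSet B) : μ ((V : Set G) • B) ≤ (V.card : ENNReal) * μ B := by
  have hsub : (V : Set G) • B ⊆ ⋃ u ∈ V, (fun x : X => u⁻¹ • x) ⁻¹' B := by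
    rintro _ ⟨u, hu, x, hx, rfl⟩
    refine Set.mem_biUnion hu ?_
    simpa using hx
  calc μ ((V : Set G) • B) ≤ μ (⋃ u ∈ V, (fun x : X => u⁻¹ • x) ⁻¹' B) := measure_mono hsub
    _ ≤ ∑ u ∈ V, μ ((fun x : X => u⁻¹ • x) ⁻¹' B) := measure_biUnion_finset_le _ _
    _ = (V.card : ENNReal) * μ B := by
      simp [(hμ _).measure_preimage hB.nullMeasurableSet]

variable [DecidableEq G]

theorem Tower.glues_level (T : Tower G) (hX : FreeBorelAction G X) (i : ℕ → Bool) (n : ℕ) :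
    Glues X (T.stage n).gap n (T.level i n) := by
  induction n with
  | zero =>
    rw [Tower.level, T.stage_zero]
    exact glues_univ.mono (by simpa using (T.good 0).symm.1)
  | succ n ih =>
    have hr := T.refines n
    obtain ⟨A, hA, hQA, hEA, hUA, hQ'⟩ := hr.gap_spec
    rw [T.level_succ]
    exact glues_blockRefine hX ih ((T.good n).depends _) ((T.good n).invariant _) (T.good n).symm
      (hr.compatible _) (hr.pattern_mem fun k => i k) hA hQA (hEA _) (hUA _) hQ'

/-- The approximations to the embedding of `X` into the limit of a branch: the `n`-th one has its
configurations in level `n`, and differs from the next one, in the layers below `n`, only on a set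
of measure at most `2⁻ⁿ`. Each bit of the injection `a` is recorded in infinitely many layers. -/
theorem Tower.exists_approximations (T : Tower G) (hX : FreeBorelAction G X) (i : ℕ → Bool)
    {μ : Measure X} [IsProbabilityMeasure μ]
    (hμ : ∀ g : G, MeasurePreserving (fun x : X => g • x) μ μ) {a : X → ℕ → Bool}
    (ha : Measurable a) :
    ∃ (ζ : ℕ → X → ℕ → Bool × Bool) (s : ℕ → Set X), (∀ n, Measurable (ζ n)) ∧
      (∀ n x, orbitConfig (ζ n) x ∈ T.level i n) ∧ (∀ n, MeasurableSet (s n)) ∧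
      (∀ n, μ (s n) ≤ 2⁻¹ ^ n) ∧ (∀ n, ∀ x ∉ s n, AgreeBelow n (ζ (n + 1) x) (ζ n x)) ∧
      ∀ n x, (ζ (n + 1) x n).1 = a x n.unpair.1 := by
  have hstep : ∀ (n : ℕ) (ζ : {ζ : X → ℕ → Bool × Bool //
      Measurable ζ ∧ ∀ x, orbitConfig ζ x ∈ T.level i n}),
      ∃ (ζ' : {ζ : X → ℕ → Bool × Bool //
          Measurable ζ ∧ ∀ x, orbitConfig ζ x ∈ T.level i (n + 1)})
        (s : Set X), MeasurableSet s ∧ μ s ≤ 2⁻¹ ^ n ∧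
        (∀ x ∉ s, AgreeBelow n (ζ'.1 x) (ζ.1 x)) ∧ ∀ x, (ζ'.1 x n).1 = a x n.unpair.1 := by
    rintro n ⟨ζ, hζm, hζ⟩
    have hr := T.refines n
    obtain ⟨ζ', B, hζ'm, hBm, hζ', hBi, hdata, hagree⟩ := (T.glues_level hX i n).exists_perturb hX
      ((T.good n).depends _) ((T.good n).invariant _) (T.good n).symm
      (hr.compatible fun k => i k) (hr.pattern_mem fun k => i k) hζm hζ
      (a := fun x => a x n.unpair.1) ((measurable_pi_apply _).comp ha)
    refine ⟨⟨ζ', hζ'm, fun x => by rw [T.level_succ]; exact hζ' x⟩,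
      _, hX.measurableSet_smul _ hBm, ?_, hagree, hdata⟩
    obtain ⟨U, hU, hUcard⟩ := hr.sparse fun k => i k
    have h1 := card_mul_measure_le_one hμ hU hBm hBi
    have h2 := measure_smul_le hμ ((T.stage n).gap * (T.block n fun k => i k).window) hBm
    have h3 : 2 ^ n * ((T.stage n).gap * (T.block n fun k => i k).window).card ≤ U.card :=
      (Nat.mul_le_mul_left _ Finset.card_mul_le).trans hUcard
    rw [← ENNReal.inv_pow, ← one_div, ENNReal.le_div_iff_mul_le (by simp) (by simp), mul_comm]
    calc (2 : ENNReal) ^ n * μ _ ≤ 2 ^ n * (_ * μ B) := by gcongr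
      _ = ((2 ^ n * ((T.stage n).gap * (T.block n fun k => i k).window).card : ℕ) : ENNReal) *
          μ B := by
        push_cast
        ring
      _ ≤ U.card * μ B := by gcongr
      _ ≤ 1 := h1
  choose next s hsm hsμ hsagree hsdata using hstep
  let ζ : ∀ n, {ζ : X → ℕ → Bool × Bool // Measurable ζ ∧ ∀ x, orbitConfig ζ x ∈ T.level i n} :=
    fun n => Nat.rec ⟨fun _ _ => (false, false), measurable_const, fun x => by
      rw [Tower.level, T.stage_zero]
      trivial⟩ (fun n ζ => next n ζ) n
  exact ⟨fun n => (ζ n).1, fun n => s n (ζ n), fun n => (ζ n).2.1, fun n => (ζ n).2.2,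
    fun n => hsm n _, fun n => hsμ n _, fun n => hsagree n _, fun n => hsdata n _⟩

instance [Countable G] (T : Tower G) (i : ℕ → Bool) : BorelSpace (T.Flow i) :=
  Subtype.borelSpace (T.flowSet i)

/-- The limit of the approximations embeds `X` into the flow, almost everywhere. -/
theorem Tower.exists_embedding [Countable G] (T : Tower G) (hX : FreeBorelAction G X)
    (i : ℕ → Bool) {μ : Measure X} [IsProbabilityMeasure μ]
    (hμ : ∀ g : G, MeasurePreserving (fun x : X => g • x) μ μ) :
    ∃ (X' : Set X) (f : X → T.Flow i), MeasurableSet X' ∧ μ X' = 1 ∧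
      (∀ g : G, ∀ x ∈ X', g • x ∈ X') ∧ @Measurable _ _ _ (borel (T.Flow i)) f ∧
      Set.InjOn f X' ∧ ∀ g : G, ∀ x ∈ X', f (g • x) = g • f x := by
  classical
  obtain ⟨a, ha, hainj⟩ := hX.separated
  obtain ⟨ζ, s, hζm, hζ, hsm, hsμ, hagree, hdata⟩ := T.exists_approximations hX i hμ ha
  -- the points near which only finitely many changes happen
  set C : Set X := {x | ∃ N, ∀ n, N ≤ n → x ∉ s n} with hC
  have hCm : MeasurableSet C := by
    have : C = ⋃ N, ⋂ n, ⋂ _ : N ≤ n, (s n)ᶜ := by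
      ext x
      simp [hC]
    rw [this]
    exact MeasurableSet.iUnion fun N => MeasurableSet.iInter fun n => MeasurableSet.iInter fun _ =>
      (hsm n).compl
  have hCae : ∀ᵐ x ∂μ, x ∈ C := by
    have hsum : ∑' n, μ (s n) ≠ ⊤ := by
      refine ne_top_of_le_ne_top ?_ (ENNReal.tsum_le_tsum hsμ)
      rw [ENNReal.tsum_geometric]
      simp
    filter_upwards [ae_eventually_notMem hsum] with x hx
    exact eventually_atTop.mp hx
  set X' : Set X := {x | ∀ g : G, g • x ∈ C} with hX'
  have hX'm : MeasurableSet X' := by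
    have : X' = ⋂ g : G, (fun x : X => g • x) ⁻¹' C := by
      ext x
      simp [hX']
    rw [this]
    exact MeasurableSet.iInter fun g => hX.measurable_smul g hCm
  have hX'ae : ∀ᵐ x ∂μ, x ∈ X' :=
    ae_all_iff.mpr fun g => (hμ g).quasiMeasurePreserving.ae hCae
  have hX'C : X' ⊆ C := fun x hx => by simpa using hx 1
  have hstable : ∀ x N, (∀ n, N ≤ n → x ∉ s n) → ∀ k m, max N (k + 1) ≤ m →
      ζ m x k = ζ (max N (k + 1)) x k := by
    intro x N hN k m hm
    induction m, hm using Nat.le_induction with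
    | base => rfl
    | succ m hm ih => rw [hagree m x (hN m (by omega)) k (by omega), ih]
  have hlim : ∀ x, ∃ l : ℕ → Bool × Bool,
      Tendsto (fun n => if x ∈ C then ζ n x else fun _ => (false, false)) atTop (𝓝 l) := by
    intro x
    by_cases hx : x ∈ C
    · obtain ⟨N, hN⟩ := id hx
      refine ⟨fun k => ζ (max N (k + 1)) x k, tendsto_pi_nhds.mpr fun k => ?_⟩
      refine tendsto_const_nhds.congr' ?_
      filter_upwards [eventually_ge_atTop (max N (k + 1))] with m hm
      simp only [hx, if_true]
      exact (hstable x N hN k m hm).symm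
    · simp only [hx, if_false]
      exact ⟨_, tendsto_const_nhds⟩
  choose L hL using hlim
  have hLm : Measurable L := measurable_of_tendsto_metrizable
    (fun n => Measurable.ite hCm (hζm n) measurable_const) (tendsto_pi_nhds.mpr hL)
  have hLC : ∀ x ∈ C, Tendsto (fun n => ζ n x) atTop (𝓝 (L x)) := fun x hx => by
    simpa only [hx, if_true] using hL x
  have hLflow : ∀ x ∈ X', orbitConfig L x ∈ T.flowSet i := by
    intro x hx
    refine Set.mem_iInter.mpr fun n => ((T.good n).closed _).mem_of_tendsto
      (f := fun m => orbitConfig (G := G) (ζ m) x) (b := atTop)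
      (tendsto_pi_nhds.mpr fun g => hLC _ (hx g)) ?_
    filter_upwards [eventually_ge_atTop n] with m hm
    exact T.level_antitone i hm (hζ m x)
  have hLdata : ∀ x ∈ C, ∃ N, ∀ k, N ≤ k → (L x k).1 = a x k.unpair.1 := by
    intro x hx
    obtain ⟨N, hN⟩ := id hx
    refine ⟨N, fun k hk => ?_⟩
    have h1 : Tendsto (fun n => ζ n x k) atTop (𝓝 (L x k)) :=
      ((continuous_apply k).tendsto _).comp (hLC x hx)
    have h2 : Tendsto (fun n => ζ n x k) atTop (𝓝 (ζ (max N (k + 1)) x k)) := by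
      refine tendsto_const_nhds.congr' ?_
      filter_upwards [eventually_ge_atTop (max N (k + 1))] with m hm
      exact (hstable x N hN k m hm).symm
    rw [tendsto_nhds_unique h1 h2, max_eq_right (by omega), hdata]
  obtain ⟨z₀, hz₀⟩ := T.flowSet_nonempty i
  refine ⟨X', fun x => ⟨if x ∈ X' then orbitConfig L x else z₀, ?_⟩, hX'm, ?_, ?_, ?_, ?_, ?_⟩
  · split_ifs with h
    · exact hLflow x h
    · exact hz₀
  · exact mem_ae_iff_prob_eq_one hX'm |>.mp hX'ae
  · intro g x hx h
    rw [smul_smul]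
    exact hx (h * g)
  · rw [← BorelSpace.measurable_eq (α := T.Flow i)]
    exact (Measurable.ite hX'm (hX.measurable_orbitConfig hLm) measurable_const).subtype_mk
  · intro x hx y hy hxy
    have hxy' : L x = L y := by
      have := congrFun (congrArg Subtype.val hxy) 1
      simpa only [hx, hy, if_true, orbitConfig, one_smul] using this
    obtain ⟨N, hN⟩ := hLdata x (hX'C hx)
    obtain ⟨M, hM⟩ := hLdata y (hX'C hy)
    -- each bit is recorded in arbitrarily high layers
    refine hainj (funext fun k => ?_)
    have hk : max N M ≤ Nat.pair k (max N M) := Nat.right_le_pair _ _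
    have h1 := hN _ ((le_max_left N M).trans hk)
    have h2 := hM _ ((le_max_right N M).trans hk)
    rw [Nat.unpair_pair] at h1 h2
    rw [← h1, ← h2, hxy']
  · intro g x hx
    have hgx : g • x ∈ X' := fun h => by
      rw [smul_smul]
      exact hx (h * g)
    refine Subtype.ext ?_
    simp only [T.coe_smul, hx, hgx, if_true]
    exact orbitConfig_smul L g x

end Universal

/-! ### Model-universality -/

section ModelUniversal

variable {G : Type u} [Group G] {X : Type w} [MulAction G X]

theorem mem_stabilizer_eq_bot_smul {x : X} (hx : MulAction.stabilizer G x = ⊥) (g : G) :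
    MulAction.stabilizer G (g • x) = ⊥ := by
  rw [MulAction.stabilizer_smul_eq_stabilizer_map_conj, hx, Subgroup.map_bot]

variable [MeasurableSpace X]

/-- A free system embeds, almost everywhere, into the limit of each branch: pass to the conull set
of points with trivial stabilizer. -/
theorem Tower.exists_embedding_of_isFreeGSystem [DecidableEq G] [Countable G] (T : Tower G)
    (i : ℕ → Bool) {μ : Measure X} (hμ : IsFreeGSystem G μ) :
    ∃ (X' : Set X) (f : X → T.Flow i), MeasurableSet X' ∧ μ X' = 1 ∧
      (∀ g : G, ∀ x ∈ X', g • x ∈ X') ∧ @Measurable _ _ _ (borel (T.Flow i)) f ∧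
      Set.InjOn f X' ∧ ∀ g : G, ∀ x ∈ X', f (g • x) = g • f x := by
  obtain ⟨⟨hsb, hprob, hmp⟩, hfree⟩ := hμ
  set X₀ : Set X := {x | MulAction.stabilizer G x = ⊥} with hX₀
  have hX₀m : MeasurableSet X₀ := by
    have : X₀ = ⋂ g : G, ⋂ _ : g ≠ 1, {x | g • x = x}ᶜ := by
      ext x
      simp only [hX₀, Set.mem_ofPred_eq, Set.mem_iInter, Set.mem_compl_iff,
        Subgroup.eq_bot_iff_forall, MulAction.mem_stabilizer_iff]
      exact forall_congr' fun g => not_imp_not.symm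
    rw [this]
    exact MeasurableSet.iInter fun g => MeasurableSet.iInter fun _ =>
      (measurableSet_eq_fun (hmp g).measurable measurable_id).compl
  have hinv : ∀ (g : G) (x : X), x ∈ X₀ → g • x ∈ X₀ := fun g x hx =>
    mem_stabilizer_eq_bot_smul hx g
  let _ : MulAction G X₀ :=
    { smul := fun g x => ⟨g • x.1, hinv g x.1 x.2⟩
      one_smul := fun x => Subtype.ext (one_smul G x.1)
      mul_smul := fun g h x => Subtype.ext (mul_smul g h x.1) }
  have hcoe : ∀ (g : G) (x : X₀), ((g • x : X₀) : X) = g • (x : X) := fun _ _ => rfl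
  have hemb : MeasurableEmbedding (Subtype.val : X₀ → X) := MeasurableEmbedding.subtype_coe hX₀m
  have hX₀μ : μ X₀ = 1 := (mem_ae_iff_prob_eq_one hX₀m).mp hfree
  have hX : FreeBorelAction G X₀ := by
    refine ⟨fun g => ((hmp g).measurable.comp measurable_subtype_coe).subtype_mk,
      fun g x hgx => ?_, MeasurableSpace.measurable_injection_nat_bool_of_countablySeparated X₀⟩
    have h : g ∈ MulAction.stabilizer G x.1 := congrArg Subtype.val hgx
    have hx : MulAction.stabilizer G x.1 = ⊥ := x.2
    rwa [hx, Subgroup.mem_bot] at h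
  have hval : ∀ S : Set X₀, μ.comap Subtype.val S = μ (Subtype.val '' S) := fun S =>
    hemb.comap_apply μ S
  have hprob₀ : IsProbabilityMeasure (μ.comap (Subtype.val : X₀ → X)) :=
    ⟨by rw [hval, Set.image_univ, Subtype.range_coe, hX₀μ]⟩
  have hmp₀ : ∀ g : G, MeasurePreserving (fun x : X₀ => g • x)
      (μ.comap Subtype.val) (μ.comap Subtype.val) := by
    refine fun g => ⟨hX.measurable_smul g, Measure.ext fun S hS => ?_⟩
    have himg : Subtype.val '' ((fun x : X₀ => g • x) ⁻¹' S) =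
        (fun x : X => g • x) ⁻¹' (Subtype.val '' S) := by
      ext x
      constructor
      · rintro ⟨y, hy, rfl⟩
        exact ⟨g • y, hy, rfl⟩
      · rintro ⟨y, hy, hyx⟩
        have hx : x ∈ X₀ := by
          have := hinv g⁻¹ y.1 y.2
          rwa [hyx, inv_smul_smul] at this
        refine ⟨⟨x, hx⟩, ?_, rfl⟩
        have : g • (⟨x, hx⟩ : X₀) = y := Subtype.ext hyx.symm
        change g • (⟨x, hx⟩ : X₀) ∈ S
        rwa [this]
    rw [Measure.map_apply (hX.measurable_smul g) hS, hval, hval, himg,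
      (hmp g).measure_preimage (hemb.measurableSet_image.mpr hS).nullMeasurableSet]
  obtain ⟨X', f, hX'm, hX'μ, hX'inv, hf, hinj, heq⟩ := T.exists_embedding hX i hmp₀
  have hne : Nonempty (T.Flow i) := (T.isFlow i).nonempty
  obtain ⟨f', hf', hff'⟩ := @MeasurableEmbedding.exists_measurable_extend _ _ _ _ _
    (borel (T.Flow i)) _ hemb _ hf fun _ => hne
  have hff : ∀ x : X₀, f' x = f x := fun x => congrFun hff' x
  refine ⟨Subtype.val '' X', f', hemb.measurableSet_image.mpr hX'm, by rw [← hval, hX'μ], ?_, hf',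
    ?_, ?_⟩
  · rintro g _ ⟨x, hx, rfl⟩
    exact ⟨g • x, hX'inv g x hx, rfl⟩
  · rintro _ ⟨x, hx, rfl⟩ _ ⟨y, hy, rfl⟩ hxy
    rw [hff, hff] at hxy
    rw [hinj hx hy hxy]
  · rintro g _ ⟨x, hx, rfl⟩
    rw [hff, ← heq g x hx, ← hff, hcoe]

/-- The image of a system under an almost everywhere equivariant map is a system. -/
theorem isGSystem_map {Y : Type v} [TopologicalSpace Y] [MulAction G Y] [MeasurableSpace Y]
    [BorelSpace Y] [StandardBorelSpace Y] (hY : IsFlow G Y) {μ : Measure X} (hμ : IsGSystem G μ)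
    {X' : Set X} (hX' : MeasurableSet X') (hX'μ : μ X' = 1) {f : X → Y} (hf : Measurable f)
    (heq : ∀ g : G, ∀ x ∈ X', f (g • x) = g • f x) : IsGSystem G (μ.map f) := by
  have := hμ.probability
  refine ⟨inferInstance, Measure.isProbabilityMeasure_map hf.aemeasurable, fun g => ?_⟩
  have hg : Measurable fun y : Y => g • y := (hY.continuous_smul g).measurable
  refine ⟨hg, ?_⟩
  have hae : (fun y : Y => g • y) ∘ f =ᵐ[μ] f ∘ fun x : X => g • x := by
    filter_upwards [(mem_ae_iff_prob_eq_one hX').mpr hX'μ] with x hx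
    exact (heq g x hx).symm
  rw [Measure.map_map hg hf, Measure.map_congr hae,
    ← Measure.map_map hf (hμ.measurePreserving g).measurable, (hμ.measurePreserving g).map_eq]

theorem Tower.isModelUniversal [DecidableEq G] [Countable G] (T : Tower G) (i : ℕ → Bool) :
    IsModelUniversal.{u, u, w} G (T.Flow i) := by
  refine ⟨T.isFlow i, inferInstance, fun X _ _ μ hμ => ?_⟩
  obtain ⟨X', f, hX'm, hX'μ, hX'inv, hf, hinj, heq⟩ := T.exists_embedding_of_isFreeGSystem i hμ
  let _ : MeasurableSpace (T.Flow i) := borel _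
  have hB : BorelSpace (T.Flow i) := ⟨rfl⟩
  have := (T.isClosed_flowSet i).polishSpace
  exact ⟨μ.map f, isGSystem_map (T.isFlow i) hμ.isGSystem hX'm hX'μ hf heq,
    X', f, hX'm, hX'μ, hX'inv, hf, hinj, heq, rfl⟩

end ModelUniversal

/-! ### Change of the acting group -/

section Transfer

variable {G : Type u} {H : Type v} [Group G] [Group H]

/-- Freeness does not change when the acting group is replaced by an isomorphic one. -/
theorem IsFreeGSystem.compHom {X : Type w} [MeasurableSpace X] [MulAction G X] (φ : H ≃* G)
    {μ : Measure X} (h : IsFreeGSystem G μ) :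
    @IsFreeGSystem H X _ _ (MulAction.compHom X φ.toMonoidHom) μ := by
  let _ := MulAction.compHom X φ.toMonoidHom
  refine ⟨⟨h.isGSystem.standardBorel, h.isGSystem.probability,
    fun g => h.isGSystem.measurePreserving (φ g)⟩, ?_⟩
  filter_upwards [h.free] with x hx
  rw [Subgroup.eq_bot_iff_forall] at hx ⊢
  exact fun g hg => φ.map_eq_one_iff.mp (hx (φ g) hg)

theorem IsMinimalFlow.compHom {Y : Type w} [TopologicalSpace Y] [MulAction H Y] (φ : G ≃* H)
    (h : IsMinimalFlow H Y) :
    @IsMinimalFlow G Y _ _ (MulAction.compHom Y φ.toMonoidHom) := by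
  let _ := MulAction.compHom Y φ.toMonoidHom
  refine ⟨⟨h.isFlow.nonempty, h.isFlow.compact, h.isFlow.hausdorff,
    fun g => h.isFlow.continuous_smul (φ g)⟩, fun y => (h.dense_orbit y).mono ?_⟩
  rintro _ ⟨k, rfl⟩
  refine ⟨φ.symm k, ?_⟩
  change φ (φ.symm k) • y = k • y
  rw [φ.apply_symm_apply]

theorem IsModelUniversal.compHom {Y : Type} [TopologicalSpace Y] [MulAction H Y] (φ : G ≃* H)
    (h : IsModelUniversal.{v, 0, w} H Y) :
    @IsModelUniversal.{u, 0, w} G Y _ _ (MulAction.compHom Y φ.toMonoidHom) := by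
  let _ := MulAction.compHom Y φ.toMonoidHom
  refine ⟨⟨h.isFlow.nonempty, h.isFlow.compact, h.isFlow.hausdorff,
    fun g => h.isFlow.continuous_smul (φ g)⟩, h.metrizable, fun X _ _ μ hμ => ?_⟩
  obtain ⟨ν, hν, X', f, hX'm, hX'μ, hX'inv, hf, hinj, heq, hmap⟩ := by
    let _ := MulAction.compHom X φ.symm.toMonoidHom
    exact h.universal X μ (hμ.compHom φ.symm)
  let _ : MeasurableSpace Y := borel Y
  have hφ : ∀ (g : G) (x : X), φ.symm (φ g) • x = g • x := fun g x => by
    rw [φ.symm_apply_apply]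
  refine ⟨ν, ⟨hν.standardBorel, hν.probability, fun g => hν.measurePreserving (φ g)⟩,
    X', f, hX'm, hX'μ, fun g x hx => ?_, hf, hinj, fun g x hx => ?_, hmap⟩
  · rw [← hφ]
    exact hX'inv (φ g) x hx
  · rw [← hφ]
    exact heq (φ g) x hx

end Transfer

theorem theorem1 (G : Type u) [Group G] [Countable G] [Infinite G]
    (I : Type v) (hI : Cardinal.mk I = Cardinal.continuum) :
    ∃ (Y : I → Type) (_ : ∀ i, TopologicalSpace (Y i)) (_ : ∀ i, MulAction G (Y i)),
      (∀ i, IsMinimalFlow G (Y i)) ∧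
      (∀ i, IsModelUniversal.{u, 0, w} G (Y i)) ∧
      MutuallyDisjoint G Y := by
  classical
  -- the flows have to live in `Type`, so that `G` is replaced by a copy of itself there
  let φ : G ≃* Shrink.{0} G := Shrink.mulEquiv.symm
  have : Infinite (Shrink.{0} G) := φ.toEquiv.infinite_iff.mp inferInstance
  have : Countable (Shrink.{0} G) := Countable.of_equiv G φ.toEquiv
  obtain ⟨T⟩ := exists_tower (Shrink.{0} G)
  have hcard : Cardinal.lift.{0} (Cardinal.mk I) = Cardinal.lift.{v} (Cardinal.mk (ℕ → Bool)) := by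
    rw [hI]
    simp
  obtain ⟨e⟩ := Cardinal.lift_mk_eq'.mp hcard
  exact ⟨fun i => T.Flow (e i), inferInstance, fun i => MulAction.compHom _ φ.toMonoidHom,
    fun i => (T.isMinimalFlow (e i)).compHom φ,
    fun i => (T.isModelUniversal (e i)).compHom φ, (T.mutuallyDisjoint e).compHom φ⟩
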